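/- Let $H:\mathbb R^2\to\mathbb R$ be $C^\infty$, let $\Delta\subset\mathbb R^m$ be compact, and let $P(x,y,\delta)$, $Q(x,y,\delta)$ be $C^\infty$ functions for $(x,y)\in\mathbb R^2$ and $\delta$ in a neighbourhood of $\Delta$. Consider $$\dot x=H_y+\varepsilon P(x,y,\delta),\qquad \dot y=-H_x+\varepsilon Q(x,y,\delta). \tag{1}$$ Suppose that for $\varepsilon=0$ system (1) has a center at $(x_0,y_0)$, $H(x_0,y_0)=h_0$: $(x_0,y_0)$ is a critical point of $H$, and there are $\beta>0$ and periodic orbits $L_h$, $h\in(h_0,h_0+\beta)$, with $H=h$ on $L_h$, which fill a punctured neighbourhood of $(x_0,y_0)$ and shrink to $(x_0,y_0)$ as $h\to h_0$. The Melnikov function of (1) near $(x_0,y_0)$ is $$M(h,\delta)=\oint_{L_h}(H_yQ+H_xP)\,dt=\oint_{L_h}Q\,dx-P\,dy ,$$ where $L_h$ is run through once in the direction of the flow. Let $u=a(x-x_0)+b(y-y_0)$, $v=c(x-x_0)+d(y-y_0)$ with $D=ad-bc\ne0$, and $\tau=kt$ with $k\neq0$. In these variables (1) becomes $\frac{du}{d\tau}=\tilde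 H_v+\varepsilon\tilde P$, $\frac{dv}{d\tau}=-\tilde H_u+\varepsilon\tilde Q$ with $$\tilde H=\tfrac Dk\,(H-h_0),\qquad \tilde P=\tfrac1k(aP+bQ),\qquad \tilde Q=\tfrac1k(cP+dQ).$$ Suppose that $\tilde H$ is in normal form at the origin: for some $\omega>0$ either $\tilde H=\frac\omega2(u^2+v^2)+\sum_{i+j\ge3}h_{ij}u^iv^j$ or $\tilde H=\frac\omega2v^2+\sum_{i+j\ge3}h_{ij}u^iv^j$ (Taylor expansions), and, for the smooth solution $\varphi(u)=O(u^2)$ of $\tilde H_v(u,\varphi(u))=0$ near $u=0$, one has $\tilde H(u,\varphi(u))=\sum_{j\ge2p}h_ju^j$ with $h_{2p}>0$, $p\ge1$. Then the transformed system has a center at the origin, with a family of periodic orbits as above, and there are functions $b_j(\delta)$, $j\ge0$, such that the Melnikov function $\tilde M$ of the transformed system near the origin satisfies $$\tilde M(h,\delta)=h^{\frac{p+1}{2p}}\sum_{j\ge0}b_j(\delta)\,h^{\frac jp},\qquad h>0,$$ and $$M(h,\delta)=(h-h_0)^{\frac{p+1}{2p}}\sum_{j\ge0}\tilde b_j(\delta)\,(h-h_0)^{\frac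 jp},\qquad h>h_0,\qquad \tilde b_j(\delta)=\operatorname{sgn}(k)\Big(\frac Dk\Big)^{\frac{1+2j-p}{2p}}b_j(\delta).$$ In particular, for $p=1$, $$M(h,\delta)=(h-h_0)\sum_{j\ge0}\tilde b_j(\delta)(h-h_0)^j,\qquad \tilde b_j(\delta)=\operatorname{sgn}(k)\Big(\frac Dk\Big)^{j}b_j(\delta).$$ (The hypotheses force $D/k>0$.) The expansions are asymptotic to all orders as $h\to0^+$, respectively $h\to h_0^+$, uniformly for $\delta\in\Delta$: the error of the partial sum over $j<N$ is $O\big((h-h_0)^{\frac{p+1}{2p}+\frac Np}\big)$ (with $h_0$ replaced by $0$ for $\tilde M$). If $H$ is analytic at $(x_0,y_0)$ and $P,Q$ are analytic at $(x_0,y_0,\delta)$ for every $\delta\in\Delta$, then the series converge to $\tilde M$ and $M$ for all $\delta\in\Delta$ and all $h$ in some interval $(0,r)$, respectively $(h_0,h_0+r)$, with $r>0$ independent of $\delta$. -/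

import Mathlib

open Set Filter Topology Asymptotics
open scoped ContDiff

noncomputable section

namespace NearHamiltonian

/-- The partial derivative `∂F/∂x` of a function on the plane. -/
def partialX (F : ℝ × ℝ → ℝ) (z : ℝ × ℝ) : ℝ := fderiv ℝ F z (1, 0)

/-- The partial derivative `∂F/∂y` of a function on the plane. -/
def partialY (F : ℝ × ℝ → ℝ) (z : ℝ × ℝ) : ℝ := fderiv ℝ F z (0, 1)

/-- `γ` is a periodic orbit of `x' = H_y`, `y' = -H_x` on the level `H = h`, with least period
`T > 0` (so `γ` runs exactly once through the closed orbit while `t` runs through `[0, T)`). -/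
structure IsPeriodicOrbit (H : ℝ × ℝ → ℝ) (h : ℝ) (γ : ℝ → ℝ × ℝ) (T : ℝ) : Prop where
  flow : ∀ t, HasDerivAt γ (partialY H (γ t), -partialX H (γ t)) t
  period_pos : 0 < T
  closed : ∀ t, γ (t + T) = γ t
  simple : InjOn γ (Ico 0 T)
  level : ∀ t, H (γ t) = h

/-- A center `z₀` of the Hamiltonian system of `H`, together with its family of periodic orbits
`L_h`, `h ∈ (h₀, h₀ + β)`, where `h₀ = H z₀`: the orbit `L_h` lies on the level `H = h`, it shrinks
to `z₀` as `h → h₀`, and the orbits fill a punctured neighbourhood of `z₀`. -/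
structure CenterFamily (H : ℝ × ℝ → ℝ) (z₀ : ℝ × ℝ) where
  critical : fderiv ℝ H z₀ = 0
  β : ℝ
  β_pos : 0 < β
  orbit : ℝ → ℝ → ℝ × ℝ
  period : ℝ → ℝ
  isPeriodicOrbit : ∀ h ∈ Ioo (H z₀) (H z₀ + β), IsPeriodicOrbit H h (orbit h) (period h)
  shrinks : ∀ U ∈ 𝓝 z₀, ∀ᶠ h in 𝓝[>] (H z₀), range (orbit h) ⊆ U
  fills : insert z₀ (⋃ h ∈ Ioo (H z₀) (H z₀ + β), range (orbit h)) ∈ 𝓝 z₀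

/-- The Melnikov function `M(h, δ) = ∮_{L_h} (H_y q + H_x p) dt = ∮_{L_h} q dx - p dy` of the system
`x' = H_y + ε p`, `y' = -H_x + ε q` near the center `z₀`. -/
def CenterFamily.melnikov {E : Type*} {H : ℝ × ℝ → ℝ} {z₀ : ℝ × ℝ} (L : CenterFamily H z₀)
    (P Q : ℝ × ℝ → E → ℝ) (h : ℝ) (δ : E) : ℝ :=
  ∫ t in (0 : ℝ)..L.period h,
    (partialY H (L.orbit h t) * Q (L.orbit h t) δ + partialX H (L.orbit h t) * P (L.orbit h t) δ)

/-- The normal form of an elementary center: `H = (κ/2) (x² + y²) + (terms of order ≥ 3)`. -/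
def IsElementaryForm (H : ℝ × ℝ → ℝ) (κ : ℝ) : Prop :=
  (fun z : ℝ × ℝ => H z - κ / 2 * (z.1 ^ 2 + z.2 ^ 2)) =O[𝓝 0] fun z => ‖z‖ ^ 3

/-- The normal form of a nilpotent critical point: `H = (κ/2) y² + (terms of order ≥ 3)`. -/
def IsNilpotentForm (H : ℝ × ℝ → ℝ) (κ : ℝ) : Prop :=
  (fun z : ℝ × ℝ => H z - κ / 2 * z.2 ^ 2) =O[𝓝 0] fun z => ‖z‖ ^ 3

/-- With `φ(x) = O(x²)` the smooth solution of `H_y(x, φ(x)) = 0` near `x = 0`, the expansion of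
`H(x, φ(x))` at `0` starts with a term `c x^{2p}`, where `c > 0`. -/
def HasCenterOrder (H : ℝ × ℝ → ℝ) (p : ℕ) : Prop :=
  ∃ φ : ℝ → ℝ, ContDiffAt ℝ ∞ φ 0 ∧ φ =O[𝓝 0] (fun x => x ^ 2) ∧
    (∀ᶠ x in 𝓝 (0 : ℝ), partialY H (x, φ x) = 0) ∧
    ∃ c : ℝ, 0 < c ∧
      (fun x => H (x, φ x) - c * x ^ (2 * p)) =O[𝓝 0] fun x => x ^ (2 * p + 1)

/-- `H` is in the normal form of an elementary center (`p = 1`) or of a nilpotent center of order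
`p - 1` (`p ≥ 2`) at the origin. -/
def IsCenterNormalForm (H : ℝ × ℝ → ℝ) (p : ℕ) : Prop :=
  (∃ κ : ℝ, 0 < κ ∧ (IsElementaryForm H κ ∨ IsNilpotentForm H κ)) ∧ HasCenterOrder H p

/-- The inverse of the linear change of variables
`u = a (x - x₀) + b (y - y₀)`, `v = c (x - x₀) + d (y - y₀)`. -/
def oldCoords (a b c d x₀ y₀ : ℝ) (w : ℝ × ℝ) : ℝ × ℝ :=
  (x₀ + 1 / (a * d - b * c) * (d * w.1 - b * w.2),
    y₀ + 1 / (a * d - b * c) * (-c * w.1 + a * w.2))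

/-- The Hamiltonian in the variables `(u, v)` and the time `τ = k t`. -/
def newH (a b c d k x₀ y₀ : ℝ) (H : ℝ × ℝ → ℝ) (w : ℝ × ℝ) : ℝ :=
  (a * d - b * c) / k * (H (oldCoords a b c d x₀ y₀ w) - H (x₀, y₀))

/-- The first component of the perturbation in the variables `(u, v)` and the time `τ = k t`. -/
def newP {E : Type*} (a b c d k x₀ y₀ : ℝ) (P Q : ℝ × ℝ → E → ℝ) (w : ℝ × ℝ) (δ : E) : ℝ :=
  1 / k * (a * P (oldCoords a b c d x₀ y₀ w) δ + b * Q (oldCoords a b c d x₀ y₀ w) δ)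

/-- The second component of the perturbation in the variables `(u, v)` and the time `τ = k t`. -/
def newQ {E : Type*} (a b c d k x₀ y₀ : ℝ) (P Q : ℝ × ℝ → E → ℝ) (w : ℝ × ℝ) (δ : E) : ℝ :=
  1 / k * (c * P (oldCoords a b c d x₀ y₀ w) δ + d * Q (oldCoords a b c d x₀ y₀ w) δ)

/-- `M(h, δ) = lead(h - h₀) ∑_{j ≥ 0} b_j(δ) e_j(h - h₀)` as an asymptotic expansion to all orders
for `h → h₀+`, uniformly for `δ ∈ Δ`. -/
def IsAsymptoticExpansion {E : Type*} (lead : ℝ → ℝ) (e : ℕ → ℝ → ℝ) (h₀ : ℝ) (Δ : Set E)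
    (M : ℝ → E → ℝ) (b : ℕ → E → ℝ) : Prop :=
  ∀ N : ℕ, ∃ C r : ℝ, 0 < r ∧ ∀ δ ∈ Δ, ∀ h ∈ Ioo h₀ (h₀ + r),
    |M h δ - lead (h - h₀) * ∑ j ∈ Finset.range N, b j δ * e j (h - h₀)|
      ≤ C * (lead (h - h₀) * e N (h - h₀))

/-- `M(h, δ) = lead(h - h₀) ∑_{j ≥ 0} b_j(δ) e_j(h - h₀)` as a convergent series, for all
`h > h₀` near `h₀` and all `δ ∈ Δ`. -/
def IsConvergentExpansion {E : Type*} (lead : ℝ → ℝ) (e : ℕ → ℝ → ℝ) (h₀ : ℝ) (Δ : Set E)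
    (M : ℝ → E → ℝ) (b : ℕ → E → ℝ) : Prop :=
  ∃ r : ℝ, 0 < r ∧ ∀ δ ∈ Δ, ∀ h ∈ Ioo h₀ (h₀ + r), ∃ S : ℝ,
    HasSum (fun j => b j δ * e j (h - h₀)) S ∧ M h δ = lead (h - h₀) * S

/-- The expansion `M(h, δ) = lead(h - h₀) ∑_{j ≥ 0} b_j(δ) e_j(h - h₀)`: asymptotic in general,
and convergent if the system is analytic. -/
def IsExpansion {E : Type*} (analytic : Prop) (lead : ℝ → ℝ) (e : ℕ → ℝ → ℝ) (h₀ : ℝ) (Δ : Set E)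
    (M : ℝ → E → ℝ) (b : ℕ → E → ℝ) : Prop :=
  IsAsymptoticExpansion lead e h₀ Δ M b ∧
    (analytic → IsConvergentExpansion lead e h₀ Δ M b)

/-- The functions `H`, `p`, `q` are real analytic near the point `z₀`, for all `δ ∈ Δ`. -/
def IsAnalyticSystem {E : Type*} [NormedAddCommGroup E] [NormedSpace ℝ E] (H : ℝ × ℝ → ℝ)
    (P Q : ℝ × ℝ → E → ℝ) (z₀ : ℝ × ℝ) (Δ : Set E) : Prop :=
  AnalyticAt ℝ H z₀ ∧ ∀ δ ∈ Δ,
    AnalyticAt ℝ (fun w : (ℝ × ℝ) × E => P w.1 w.2) (z₀, δ) ∧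
    AnalyticAt ℝ (fun w : (ℝ × ℝ) × E => Q w.1 w.2) (z₀, δ)

end NearHamiltonian

end

noncomputable section

/-!
Near the origin there are smooth coordinates `X(u)`, `Y(u, v)` in which the Hamiltonian in normal
form is `X^{2p} + Y^2`. The one-form `q du - p dv` differs from some `K du` by an exact form, so the
Melnikov function at the level `ρ^{2p}` is the integral of a one-form `f dX` over the closed curve
`X^{2p} + Y^2 = ρ^{2p}`; only the part of `f` odd in `Y` contributes. Putting `X = ρ s` extracts the
factor `ρ^{p+1}` and leaves a smooth even function of `ρ`, analytic if the system is, whose Taylor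
expansion in powers of `ρ^2` is the expansion in powers of `h^{1/p}`, where `h = ρ^{2p}`. The linear
change of variables multiplies the energy by `D/k` and the Melnikov function by `sgn(k) D/k`, the
sign because time is reversed for `k < 0`.
-/

namespace NearHamiltonian

section ParametricIntegral

open MeasureTheory

variable {E Y G : Type*} [TopologicalSpace E] [TopologicalSpace Y] {a b : ℝ} {σ : ℝ → Y} {x₀ : E}

theorem eventually_forall_arc (hσ : Continuous σ) {q : E × Y → Prop}
    (h : ∀ s ∈ Icc a b, ∀ᶠ z in 𝓝 (x₀, σ s), q z) :
    ∀ᶠ x in 𝓝 x₀, ∀ s ∈ Icc a b, q (x, σ s) :=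
  isCompact_Icc.eventually_forall_of_forall_eventually (P := fun x s => q (x, σ s)) fun s hs =>
    (Continuous.tendsto (f := fun z : E × ℝ => (z.1, σ z.2)) (by fun_prop) (x₀, s)).eventually
      (h s hs)

theorem continuousOn_comp_arc [TopologicalSpace G] {f : E × Y → G} (hσ : Continuous σ)
    (h : ∀ s ∈ Icc a b, ContinuousAt f (x₀, σ s)) :
    ContinuousOn (fun s => f (x₀, σ s)) (Icc a b) := fun s hs =>
  (ContinuousAt.comp (f := fun s => (x₀, σ s)) (h s hs) (by fun_prop)).continuousWithinAt

variable [NormedAddCommGroup G] {f : E × Y → G}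

theorem exists_bound_comp_arc (hσ : Continuous σ) (h : ∀ s ∈ Icc a b, ContinuousAt f (x₀, σ s)) :
    ∃ C, ∀ᶠ x in 𝓝 x₀, ∀ s ∈ Icc a b, ‖f (x, σ s)‖ ≤ C := by
  obtain ⟨C, hC⟩ := isCompact_Icc.exists_bound_of_continuousOn (continuousOn_comp_arc hσ h)
  refine ⟨C + 1, eventually_forall_arc (q := fun z => ‖f z‖ ≤ C + 1) hσ fun s hs => ?_⟩
  exact (h s hs).norm.eventually_le_const ((hC s hs).trans_lt (lt_add_one C))

theorem aestronglyMeasurable_comp_arc (hab : a ≤ b) (hσ : Continuous σ)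
    (h : ∀ s ∈ Icc a b, ContinuousAt f (x₀, σ s)) :
    AEStronglyMeasurable (fun s => f (x₀, σ s)) (volume.restrict (uIoc a b)) := by
  rw [uIoc_of_le hab]
  exact ((continuousOn_comp_arc hσ h).mono Ioc_subset_Icc_self).aestronglyMeasurable
    measurableSet_Ioc

theorem continuousAt_integral_arc {E : Type*} [NormedAddCommGroup E] {x₀ : E} {f : E × Y → G}
    [NormedSpace ℝ G] (hab : a ≤ b) (hσ : Continuous σ)
    (h : ∀ s ∈ Icc a b, ∀ᶠ z in 𝓝 (x₀, σ s), ContinuousAt f z) :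
    ContinuousAt (fun x => ∫ s in a..b, f (x, σ s)) x₀ := by
  have hIoc : ∀ {s}, s ∈ uIoc a b → s ∈ Icc a b := fun hs =>
    Ioc_subset_Icc_self (uIoc_of_le hab ▸ hs)
  obtain ⟨C, hC⟩ := exists_bound_comp_arc hσ fun s hs => (h s hs).self_of_nhds
  refine intervalIntegral.continuousAt_of_dominated_interval (bound := fun _ => C) ?_ ?_
    intervalIntegrable_const (Eventually.of_forall fun s hs => ?_)
  · filter_upwards [eventually_forall_arc hσ h] with x hx
    exact aestronglyMeasurable_comp_arc hab hσ hx
  · filter_upwards [hC] with x hx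
    exact Eventually.of_forall fun s hs => hx s (hIoc hs)
  · exact ContinuousAt.comp (f := fun x => (x, σ s)) (h s (hIoc hs)).self_of_nhds (by fun_prop)

end ParametricIntegral

section ParametricDerivative

open MeasureTheory

universe u v w

theorem hasFDerivAt_integral_arc {E Y G : Type*} [NormedAddCommGroup E] [NormedSpace ℝ E]
    [NormedAddCommGroup Y] [NormedSpace ℝ Y] [NormedAddCommGroup G] [NormedSpace ℝ G]
    {a b : ℝ} {σ : ℝ → Y} {x₀ : E} {f : E × Y → G} (hab : a ≤ b) (hσ : Continuous σ)
    (h : ∀ s ∈ Icc a b, ContDiffAt ℝ 1 f (x₀, σ s)) :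
    HasFDerivAt (fun x => ∫ s in a..b, f (x, σ s))
      (∫ s in a..b, (fderiv ℝ f (x₀, σ s)).comp (ContinuousLinearMap.inl ℝ E Y)) x₀ := by
  have hIoc : ∀ {s}, s ∈ uIoc a b → s ∈ Icc a b := fun hs =>
    Ioc_subset_Icc_self (uIoc_of_le hab ▸ hs)
  have hev := eventually_forall_arc hσ fun s hs => (h s hs).eventually (by simp)
  have hc : ∀ s ∈ Icc a b, ContinuousAt
      (fun z => (fderiv ℝ f z).comp (ContinuousLinearMap.inl ℝ E Y)) (x₀, σ s) := fun s hs =>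
    ((h s hs).continuousAt_fderiv (by simp)).clm_comp continuousAt_const
  obtain ⟨C, hC⟩ := exists_bound_comp_arc hσ hc
  refine intervalIntegral.hasFDerivAt_integral_of_dominated_of_fderiv_le (bound := fun _ => C)
    (F' := fun x s => (fderiv ℝ f (x, σ s)).comp (ContinuousLinearMap.inl ℝ E Y))
    (hev.and hC) ?_
    ((continuousOn_comp_arc hσ fun s hs => (h s hs).continuousAt).intervalIntegrable_of_Icc hab)
    (aestronglyMeasurable_comp_arc hab hσ hc)
    (Eventually.of_forall fun s hs x hx => hx.2 s (hIoc hs)) intervalIntegrable_const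
    (Eventually.of_forall fun s hs x hx => ?_)
  · filter_upwards [hev] with x hx
    exact aestronglyMeasurable_comp_arc hab hσ fun s hs => (hx s hs).continuousAt
  · exact ((hx.1 s (hIoc hs)).differentiableAt one_ne_zero).hasFDerivAt.comp x
      (hasFDerivAt_prodMk_left x (σ s))

variable {E : Type u} {Y : Type v} [NormedAddCommGroup E] [NormedSpace ℝ E]
  [NormedAddCommGroup Y] [NormedSpace ℝ Y] {a b : ℝ} {σ : ℝ → Y} {x₀ : E}

-- The induction passes from `G` to `E →L[ℝ] G`, so the two must live in the same universe.
theorem contDiffAt_natCast_integral_arc {G : Type (max u w)} [NormedAddCommGroup G]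
    [NormedSpace ℝ G] {f : E × Y → G} (hab : a ≤ b) (hσ : Continuous σ) (m : ℕ)
    (h : ∀ s ∈ Icc a b, ContDiffAt ℝ m f (x₀, σ s)) :
    ContDiffAt ℝ m (fun x => ∫ s in a..b, f (x, σ s)) x₀ := by
  induction m generalizing G with
  | zero =>
    have hcont : ∀ᶠ x in 𝓝 x₀, ContinuousAt (fun x => ∫ s in a..b, f (x, σ s)) x := by
      refine (eventually_forall_arc (q := fun z => ∀ᶠ z' in 𝓝 z, ContinuousAt f z') hσ
        fun s hs => ?_).mono fun x hx => continuousAt_integral_arc hab hσ hx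
      exact (((h s hs).eventually (by simp)).mono fun z hz => hz.continuousAt).eventually_nhds
    exact contDiffAt_zero.2 ⟨_, hcont, fun x hx => ContinuousAt.continuousWithinAt hx⟩
  | succ m ih =>
    push_cast at h ⊢
    refine contDiffAt_succ_iff_hasFDerivAt.2
      ⟨fun x => ∫ s in a..b, (fderiv ℝ f (x, σ s)).comp (ContinuousLinearMap.inl ℝ E Y), ?_, ?_⟩
    · refine ⟨_, eventually_forall_arc (q := ContDiffAt ℝ 1 f) hσ fun s hs => ?_,
        fun x hx => hasFDerivAt_integral_arc hab hσ hx⟩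
      exact ((h s hs).of_le (by simp)).eventually (by simp)
    · exact ih (f := fun z => (fderiv ℝ f z).comp (ContinuousLinearMap.inl ℝ E Y)) fun s hs =>
        ((h s hs).fderiv_right le_rfl).clm_comp contDiffAt_const

end ParametricDerivative

section PowerSeries

open MeasureTheory
open scoped NNReal ENNReal

variable {E Y G : Type*} [NormedAddCommGroup E] [NormedSpace ℝ E]
  [NormedAddCommGroup Y] [NormedSpace ℝ Y] [NormedAddCommGroup G] [NormedSpace ℝ G]

/-- The power series of `x ↦ f (x, y₀ + w)` when `p` is the power series of `f` at `(x₀, y₀)`. -/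
def fiberSeries (p : FormalMultilinearSeries ℝ (E × Y) G) (w : Y) : FormalMultilinearSeries ℝ E G :=
  (p.changeOrigin (0, w)).compContinuousLinearMap (ContinuousLinearMap.inl ℝ E Y)

variable {p : FormalMultilinearSeries ℝ (E × Y) G} {r : ℝ≥0}

theorem exists_bound_fiberSeries (hr : (r : ℝ≥0∞) + r < p.radius) :
    ∃ B : ℕ → ℝ≥0, Summable (fun k => B k * r ^ k) ∧
      ∀ w : Y, ‖w‖₊ ≤ r → ∀ k, ‖fiberSeries p w k‖₊ ≤ B k := by
  refine ⟨fun k => ∑' s : Σ l : ℕ, { s : Finset (Fin (k + l)) // s.card = l },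
    ‖p (k + s.1)‖₊ * r ^ s.1, ?_, fun w hw k => ?_⟩
  · simpa only [← NNReal.tsum_mul_right] using
      (NNReal.summable_sigma.1 (p.changeOriginSeries_summable_aux₁ hr)).2
  have hr' : (r : ℝ≥0∞) < p.radius := le_self_add.trans_lt hr
  have hw' : ‖((0 : E), w)‖₊ ≤ r := by simpa [Prod.nnnorm_def] using hw
  have hwr : (‖((0 : E), w)‖₊ : ℝ≥0∞) < p.radius := (ENNReal.coe_le_coe.2 hw').trans_lt hr'
  calc ‖fiberSeries p w k‖₊
      ≤ ‖p.changeOrigin ((0 : E), w) k‖₊ * ‖ContinuousLinearMap.inl ℝ E Y‖₊ ^ k :=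
        FormalMultilinearSeries.nnnorm_compContinuousLinearMap_le _ _ _
    _ ≤ ‖p.changeOrigin ((0 : E), w) k‖₊ * 1 := by
        gcongr
        exact pow_le_one₀ zero_le (ContinuousLinearMap.norm_inl_le_one ℝ E Y)
    _ ≤ _ := by
        rw [mul_one]
        refine (p.nnnorm_changeOrigin_le k hwr).trans ?_
        refine Summable.tsum_le_tsum (fun i => ?_) (p.changeOriginSeries_summable_aux₂ hwr k)
          (p.changeOriginSeries_summable_aux₂ hr' k)
        gcongr

theorem hasFPowerSeriesOnBall_fiberSeries {f : E × Y → G} {R : ℝ≥0∞} {x₀ : E} {y₀ y : Y}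
    [CompleteSpace G] (hf : HasFPowerSeriesOnBall f p (x₀, y₀) R) (h0 : 0 < r)
    (hr : (r : ℝ≥0∞) + r < R) (hy : ‖y - y₀‖₊ ≤ r) :
    HasFPowerSeriesOnBall (fun x => f (x, y)) (fiberSeries p (y - y₀)) x₀ r := by
  obtain ⟨B, hB, hpB⟩ := exists_bound_fiberSeries (hr.trans_le hf.r_le)
  refine ⟨FormalMultilinearSeries.le_radius_of_summable_nnnorm _ ?_, by simpa using h0,
    fun {x} hx => ?_⟩
  · exact NNReal.summable_of_le (fun k => mul_le_mul_left (hpB _ hy k) _) hB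
  have hw : ‖((0 : E), y - y₀)‖₊ ≤ r := by simpa [Prod.nnnorm_def] using hy
  have hx' : ‖((x, 0) : E × Y)‖ₑ < r := by
    simpa [enorm_eq_nnnorm, Prod.nnnorm_def, ← NNReal.coe_lt_coe] using hx
  have hwR : (‖((0 : E), y - y₀)‖₊ : ℝ≥0∞) < R :=
    (ENNReal.coe_le_coe.2 hw).trans_lt (le_self_add.trans_lt hr)
  have hxR : ((x, 0) : E × Y) ∈ Metric.eball 0 (R - ‖((0 : E), y - y₀)‖₊) := by
    rw [mem_eball_zero_iff, lt_tsub_iff_right]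
    exact (add_le_add hx'.le (ENNReal.coe_le_coe.2 hw)).trans_lt hr
  have hsum := (hf.changeOrigin hwR).hasSum hxR
  rwa [Prod.mk_add_mk, Prod.mk_add_mk, add_sub_cancel, add_zero, add_zero] at hsum

theorem continuousOn_fiberSeries [CompleteSpace G] (hr : (r : ℝ≥0∞) < p.radius) (k : ℕ) :
    ContinuousOn (fun w => fiberSeries p w k) {w | ‖w‖₊ ≤ r} := by
  have hp : ContinuousOn (fun w : Y => p.changeOrigin ((0 : E), w) k) {w | ‖w‖₊ ≤ r} := by
    refine (p.hasFPowerSeriesOnBall_changeOrigin k (pos_of_gt hr)).continuousOn.comp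
      (by fun_prop) fun w hw => ?_
    rw [mem_eball_zero_iff]
    refine lt_of_le_of_lt (ENNReal.coe_le_coe.2 ?_) hr
    simpa [Prod.nnnorm_def] using hw
  exact (ContinuousMultilinearMap.compContinuousLinearMapL (𝕜 := ℝ) (F := G)
    (fun _ : Fin k => ContinuousLinearMap.inl ℝ E Y)).continuous.comp_continuousOn hp

theorem hasFPowerSeriesOnBall_integral {α : Type*} [MeasurableSpace α] {μ : Measure α}
    [IsFiniteMeasure μ] [CompleteSpace G] {F : E → α → G} {q : α → FormalMultilinearSeries ℝ E G}
    {x₀ : E} {B : ℕ → ℝ≥0} (hr : 0 < r)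
    (hF : ∀ᵐ s ∂μ, HasFPowerSeriesOnBall (fun x => F x s) (q s) x₀ r)
    (hq : ∀ k, AEStronglyMeasurable (fun s => q s k) μ)
    (hB : ∀ k, ∀ᵐ s ∂μ, ‖q s k‖ ≤ B k) (hsum : Summable fun k => B k * r ^ k) :
    HasFPowerSeriesOnBall (fun x => ∫ s, F x s ∂μ) (fun k => ∫ s, q s k ∂μ) x₀ r := by
  have hsum' : Summable fun k => (B k : ℝ) * (r : ℝ) ^ k := by exact_mod_cast hsum
  refine ⟨FormalMultilinearSeries.le_radius_of_summable _ ?_, by simpa using hr, fun {x} hx => ?_⟩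
  · refine (hsum'.mul_left (μ.real univ)).of_nonneg_of_le (fun k => by positivity) fun k => ?_
    calc ‖∫ s, q s k ∂μ‖ * (r : ℝ) ^ k ≤ (B k * μ.real univ) * (r : ℝ) ^ k := by
          gcongr
          exact norm_integral_le_of_norm_le_const (hB k)
      _ = _ := by ring
  have hxr : ‖x‖ ≤ r := le_of_lt (by simpa using hx)
  have happly : ∀ k, (∫ s, q s k ∂μ) (fun _ => x) = ∫ s, q s k (fun _ => x) ∂μ := fun k =>
    ContinuousMultilinearMap.integral_apply (Integrable.of_bound (hq k) (B k) (hB k)) _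
  simp only [happly]
  refine hasSum_integral_of_dominated_convergence (fun k _ => (B k : ℝ) * (r : ℝ) ^ k)
    (fun k => ?_) (fun k => ?_) (Eventually.of_forall fun _ => hsum') (integrable_const _)
    (hF.mono fun s hs => hs.hasSum hx)
  · exact (ContinuousMultilinearMap.apply ℝ (fun _ : Fin k => E) G
      (fun _ => x)).continuous.comp_aestronglyMeasurable (hq k)
  · filter_upwards [hB k] with s hs
    refine ((q s k).le_opNorm _).trans ?_
    simp only [Finset.prod_const, Finset.card_univ, Fintype.card_fin]
    gcongr

variable [CompleteSpace G] {a b : ℝ} {σ : ℝ → Y} {x₀ : E} {f : E × Y → G}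

theorem analyticAt_integral_arc_of_forall_nnnorm_le {y₀ : Y} {R : ℝ≥0∞} (hab : a ≤ b)
    (hσ : Continuous σ) (hf : HasFPowerSeriesOnBall f p (x₀, y₀) R) (h0 : 0 < r)
    (hr : (r : ℝ≥0∞) + r < R) (hσr : ∀ s ∈ Icc a b, ‖σ s - y₀‖₊ ≤ r) :
    AnalyticAt ℝ (fun x => ∫ s in a..b, f (x, σ s)) x₀ := by
  have hrp : (r : ℝ≥0∞) + r < p.radius := hr.trans_le hf.r_le
  have hIoc : ∀ s ∈ Ioc a b, ‖σ s - y₀‖₊ ≤ r := fun s hs => hσr s (Ioc_subset_Icc_self hs)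
  obtain ⟨B, hB, hpB⟩ := exists_bound_fiberSeries hrp
  simp only [intervalIntegral.integral_of_le hab]
  refine (hasFPowerSeriesOnBall_integral (q := fun s => fiberSeries p (σ s - y₀)) h0 ?_
    (fun k => ?_) (fun k => ?_) hB).analyticAt
  · exact ae_restrict_of_forall_mem measurableSet_Ioc fun s hs =>
      hasFPowerSeriesOnBall_fiberSeries hf h0 hr (hIoc s hs)
  · exact ((continuousOn_fiberSeries (le_self_add.trans_lt hrp) k).comp
      (hσ.sub continuous_const).continuousOn hIoc).aestronglyMeasurable measurableSet_Ioc
  · exact ae_restrict_of_forall_mem measurableSet_Ioc fun s hs => hpB _ (hIoc s hs) k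

theorem exists_radius_analyticAt_integral_arc (hσ : Continuous σ) {y₀ : Y}
    (hf : AnalyticAt ℝ f (x₀, y₀)) :
    ∃ r : ℝ≥0, 0 < r ∧ ∀ ⦃c d : ℝ⦄, c ≤ d → (∀ s ∈ Icc c d, ‖σ s - y₀‖₊ < r) →
      AnalyticAt ℝ (fun x => ∫ s in c..d, f (x, σ s)) x₀ := by
  obtain ⟨p, R, hp⟩ := hf
  obtain ⟨r, hr0, hrR⟩ := ENNReal.lt_iff_exists_nnreal_btwn.1 hp.r_pos
  refine ⟨r / 2, half_pos (by exact_mod_cast hr0), fun c d hcd h => ?_⟩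
  refine analyticAt_integral_arc_of_forall_nnnorm_le hcd hσ hp (half_pos (by exact_mod_cast hr0)) ?_
    fun s hs => (h s hs).le
  rwa [← ENNReal.coe_add, add_halves]

theorem analyticAt_integral_arc (hab : a ≤ b) (hσ : Continuous σ)
    (h : ∀ s ∈ Icc a b, AnalyticAt ℝ f (x₀, σ s)) :
    AnalyticAt ℝ (fun x => ∫ s in a..b, f (x, σ s)) x₀ := by
  choose! r hr0 hr using fun s hs => exists_radius_analyticAt_integral_arc hσ (h s hs)
  obtain ⟨t, ht0, htmono, ⟨N, htN⟩, htr⟩ := exists_monotone_Icc_subset_open_cover_Icc hab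
    (c := fun s : Icc a b => {t : Icc a b | ‖σ t - σ s‖₊ < r s})
    (fun s => isOpen_lt (by fun_prop) continuous_const)
    fun s _ => mem_iUnion.2 ⟨s, by simpa using hr0 s s.2⟩
  have hpiece : ∀ i, AnalyticAt ℝ (fun x => ∫ s in (t i : ℝ)..t (i + 1), f (x, σ s)) x₀ :=
    fun i => by
      obtain ⟨s, hs⟩ := htr i
      exact hr s s.2 (htmono i.le_succ) fun x hx =>
        hs (a := ⟨x, (t i).2.1.trans hx.1, hx.2.trans (t (i + 1)).2.2⟩) hx
  have hsum : ∀ᶠ x in 𝓝 x₀, ∑ i ∈ Finset.range N, ∫ s in (t i : ℝ)..t (i + 1), f (x, σ s) =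
      ∫ s in a..b, f (x, σ s) := by
    filter_upwards [eventually_forall_arc hσ fun s hs => (h s hs).eventually_continuousAt] with x hx
    rw [intervalIntegral.sum_integral_adjacent_intervals (a := fun i => (t i : ℝ)), ht0,
      htN N le_rfl]
    exact fun i _ => ((continuousOn_comp_arc hσ hx).mono
      (Icc_subset_Icc (t i).2.1 (t (i + 1)).2.2)).intervalIntegrable_of_Icc (htmono i.le_succ)
  exact (Finset.analyticAt_fun_sum _ fun i _ => hpiece i).congr hsum

universe u v w

theorem contDiffAt_integral_arc {E : Type u} {Y : Type v} {G : Type w} [NormedAddCommGroup E]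
    [NormedSpace ℝ E] [NormedAddCommGroup Y] [NormedSpace ℝ Y] [NormedAddCommGroup G]
    [NormedSpace ℝ G] [CompleteSpace G] {n : WithTop ℕ∞} {a b : ℝ} {σ : ℝ → Y} {x₀ : E}
    {f : E × Y → G} (hab : a ≤ b) (hσ : Continuous σ)
    (h : ∀ s ∈ Icc a b, ContDiffAt ℝ n f (x₀, σ s)) :
    ContDiffAt ℝ n (fun x => ∫ s in a..b, f (x, σ s)) x₀ := by
  induction n with
  | top => exact (analyticAt_integral_arc hab hσ fun s hs => (h s hs).analyticAt).contDiffAt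
  | coe n =>
    refine contDiffWithinAt_univ.1 (contDiffWithinAt_iff_forall_nat_le.2 fun m hm => ?_)
    rw [contDiffWithinAt_univ]
    let e : ULift.{u} G ≃L[ℝ] G := ContinuousLinearEquiv.ulift
    have hlift : ContDiffAt ℝ m (fun x => ∫ s in a..b, e.symm (f (x, σ s))) x₀ :=
      contDiffAt_natCast_integral_arc.{u, v, w} (f := fun z => e.symm (f z)) hab hσ m fun s hs =>
        e.symm.contDiff.contDiffAt.comp _ ((h s hs).of_le (by exact_mod_cast hm))
    refine (e.contDiff.contDiffAt.comp x₀ hlift).congr_of_eventuallyEq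
      (Eventually.of_forall fun x => ?_)
    simp only [intervalIntegral, Function.comp_apply, e.symm.integral_comp_comm, map_sub,
      e.apply_symm_apply]

end PowerSeries

section Hadamard

variable {E : Type*} [NormedAddCommGroup E] [NormedSpace ℝ E] {m n : WithTop ℕ∞} {h : E × ℝ → ℝ}

theorem add_one_le_of_infty_le (hn : ∞ ≤ n) : n + 1 ≤ n := by
  induction n with
  | top => exact le_top
  | coe n => exact_mod_cast top_le_iff.1 (by exact_mod_cast hn : ⊤ ≤ n) ▸ le_top

theorem one_le_of_infty_le (hn : ∞ ≤ n) : 1 ≤ n := le_add_self.trans (add_one_le_of_infty_le hn)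

theorem ne_zero_of_infty_le (hn : ∞ ≤ n) : n ≠ 0 :=
  (zero_lt_one.trans_le (one_le_of_infty_le hn)).ne'

/-- The quotient `h (x, y) / y` of a function that vanishes for `y = 0`, in Hadamard's form as the
mean of `∂h/∂y` over the segment from `(x, 0)` to `(x, y)`, which makes sense for `y = 0` too. -/
def hadamardQuotient (h : E × ℝ → ℝ) (z : E × ℝ) : ℝ :=
  ∫ t in (0 : ℝ)..1, fderiv ℝ h (z.1, t * z.2) (0, 1)

theorem hadamardQuotient_zero (h : E × ℝ → ℝ) (x : E) :
    hadamardQuotient h (x, 0) = fderiv ℝ h (x, 0) (0, 1) := by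
  simp [hadamardQuotient]

theorem contDiffAt_hadamardQuotient {z : E × ℝ} (hmn : m + 1 ≤ n)
    (hh : ∀ t ∈ Icc (0 : ℝ) 1, ContDiffAt ℝ n h (z.1, t * z.2)) :
    ContDiffAt ℝ m (hadamardQuotient h) z := by
  refine contDiffAt_integral_arc (σ := id) (f := fun w : (E × ℝ) × ℝ =>
    fderiv ℝ h (w.1.1, w.2 * w.1.2) (0, 1)) zero_le_one continuous_id fun t ht => ?_
  refine ContDiffAt.clm_apply ?_ contDiffAt_const
  exact ContDiffAt.comp (f := fun w : (E × ℝ) × ℝ => (w.1.1, w.2 * w.1.2)) (z, t)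
    ((hh t ht).fderiv_right hmn) (by fun_prop)

theorem eq_mul_hadamardQuotient {z : E × ℝ}
    (hh : ∀ t ∈ Icc (0 : ℝ) 1, ContDiffAt ℝ 1 h (z.1, t * z.2)) (h0 : h (z.1, 0) = 0) :
    h z = z.2 * hadamardQuotient h z := by
  have hderiv : ∀ t ∈ uIcc (0 : ℝ) 1,
      HasDerivAt (fun t => h (z.1, t * z.2)) (fderiv ℝ h (z.1, t * z.2) (0, 1) * z.2) t := by
    intro t ht
    rw [uIcc_of_le zero_le_one] at ht
    have hline : HasDerivAt (fun t : ℝ => (z.1, t * z.2)) (0, z.2) t :=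
      (hasDerivAt_const t z.1).prodMk (hasDerivAt_mul_const z.2)
    refine (((hh t ht).differentiableAt one_ne_zero).hasFDerivAt.comp_hasDerivAt t
      hline).congr_deriv ?_
    rw [← mul_one z.2, ← smul_eq_mul z.2, ← smul_zero z.2, ← Prod.smul_mk, map_smul]
    simp [mul_comm]
  have hcont : ContinuousOn (fun t => fderiv ℝ h (z.1, t * z.2) (0, 1) * z.2) (Icc 0 1) := by
    intro t ht
    refine ContinuousAt.continuousWithinAt ?_
    exact ((ContinuousAt.comp (f := fun t : ℝ => (z.1, t * z.2))
      ((hh t ht).continuousAt_fderiv one_ne_zero) (by fun_prop)).clm_apply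
        continuousAt_const).mul continuousAt_const
  have hint := intervalIntegral.integral_eq_sub_of_hasDerivAt hderiv
    (hcont.intervalIntegrable_of_Icc zero_le_one)
  simp only [intervalIntegral.integral_mul_const, one_mul, zero_mul, h0, sub_zero] at hint
  rw [hadamardQuotient, mul_comm, hint]

theorem eventually_eq_mul_hadamardQuotient {x₀ : E} (hh : ContDiffAt ℝ 1 h (x₀, 0))
    (h0 : ∀ᶠ x in 𝓝 x₀, h (x, 0) = 0) :
    ∀ᶠ z in 𝓝 (x₀, (0 : ℝ)), h z = z.2 * hadamardQuotient h z := by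
  have hsegment : ∀ᶠ z in 𝓝 (x₀, (0 : ℝ)), ∀ t ∈ Icc (0 : ℝ) 1,
      ContDiffAt ℝ 1 h (z.1, t * z.2) := by
    refine eventually_forall_arc (σ := id)
      (q := fun w : (E × ℝ) × ℝ => ContDiffAt ℝ 1 h (w.1.1, w.2 * w.1.2)) continuous_id
      fun t _ => ?_
    have hcont : ContinuousAt (fun w : (E × ℝ) × ℝ => (w.1.1, w.2 * w.1.2)) ((x₀, 0), t) := by
      fun_prop
    exact hcont.eventually (by simpa using hh.eventually (by simp))
  filter_upwards [hsegment, continuousAt_fst.eventually h0] with z hz hz0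
  exact eq_mul_hadamardQuotient hz hz0

theorem contDiffAt_hadamardQuotient_zero {x₀ : E} (hmn : m + 1 ≤ n)
    (hh : ContDiffAt ℝ n h (x₀, 0)) : ContDiffAt ℝ m (hadamardQuotient h) (x₀, 0) :=
  contDiffAt_hadamardQuotient hmn fun t _ => by simpa using hh

theorem eventually_eq_sq_mul_hadamardQuotient {x₀ : E} (hh : ContDiffAt ℝ 2 h (x₀, 0))
    (h0 : ∀ᶠ x in 𝓝 x₀, h (x, 0) = 0) (h1 : ∀ᶠ x in 𝓝 x₀, fderiv ℝ h (x, 0) (0, 1) = 0) :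
    ∀ᶠ z in 𝓝 (x₀, (0 : ℝ)), h z = z.2 ^ 2 * hadamardQuotient (hadamardQuotient h) z := by
  have hquot := contDiffAt_hadamardQuotient_zero (m := 1) one_add_one_eq_two.le hh
  filter_upwards [eventually_eq_mul_hadamardQuotient (hh.of_le one_le_two) h0,
    eventually_eq_mul_hadamardQuotient hquot (by simpa only [hadamardQuotient_zero] using h1)]
    with z hz hz'
  rw [hz, hz', sq, mul_assoc]

end Hadamard

section OneVariable

variable {n : WithTop ℕ∞} {f g : ℝ → ℝ}

theorem exists_eq_mul_of_contDiffAt (hn : ∞ ≤ n) (hf : ContDiffAt ℝ n f 0) (hf0 : f 0 = 0) :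
    ∃ g : ℝ → ℝ, ContDiffAt ℝ n g 0 ∧ ∀ᶠ x in 𝓝 0, f x = x * g x := by
  have hf' : ContDiffAt ℝ n (fun z : ℝ × ℝ => f z.2) (0, 0) :=
    ContDiffAt.comp (g := f) (0, 0) hf contDiffAt_snd
  have hι : ContDiffAt ℝ n (fun x : ℝ => ((0 : ℝ), x)) 0 := by fun_prop
  exact ⟨fun x => hadamardQuotient (fun z : ℝ × ℝ => f z.2) (0, x),
    ContDiffAt.comp (0 : ℝ) (contDiffAt_hadamardQuotient_zero (add_one_le_of_infty_le hn) hf') hι,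
    hι.continuousAt.eventually (eventually_eq_mul_hadamardQuotient
      (hf'.of_le (one_le_of_infty_le hn)) (Eventually.of_forall fun _ => hf0))⟩

theorem isBigO_pow_of_mul_isBigO_pow {j : ℕ} (hg : ContinuousAt g 0)
    (hO : (fun x => x * g x) =O[𝓝 0] fun x => x ^ (j + 1)) : g =O[𝓝 0] fun x => x ^ j := by
  obtain ⟨C, hC⟩ := hO.bound
  have hpunctured : ∀ᶠ x in 𝓝[≠] (0 : ℝ), ‖g x‖ ≤ C * ‖x ^ j‖ := by
    filter_upwards [mem_nhdsWithin_of_mem_nhds hC, self_mem_nhdsWithin] with x hx hx0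
    refine le_of_mul_le_mul_left ?_ (norm_pos_iff.2 hx0)
    rw [norm_mul, pow_succ', norm_mul] at hx
    linarith
  have hzero : ‖g 0‖ ≤ C * ‖(0 : ℝ) ^ j‖ :=
    le_of_tendsto_of_tendsto (hg.norm.mono_left nhdsWithin_le_nhds)
      ((Continuous.tendsto (f := fun x : ℝ => C * ‖x ^ j‖) (by fun_prop) 0).mono_left
        nhdsWithin_le_nhds) hpunctured
  refine IsBigO.of_bound C ?_
  filter_upwards [eventually_nhdsWithin_iff.1 hpunctured] with x hx
  rcases eq_or_ne x 0 with rfl | hx0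
  · exact hzero
  · exact hx hx0

theorem exists_eq_pow_mul (hn : ∞ ≤ n) (j : ℕ) (hf : ContDiffAt ℝ n f 0)
    (hO : f =O[𝓝 0] fun x => x ^ j) :
    ∃ g : ℝ → ℝ, ContDiffAt ℝ n g 0 ∧ ∀ᶠ x in 𝓝 0, f x = x ^ j * g x := by
  induction j generalizing f with
  | zero => exact ⟨f, hf, by simp⟩
  | succ j ih =>
    have hf0 : f 0 = 0 := by simpa using hO.eq_zero_imp.self_of_nhds
    obtain ⟨g, hg, hfg⟩ := exists_eq_mul_of_contDiffAt hn hf hf0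
    obtain ⟨q, hq, hgq⟩ := ih hg (isBigO_pow_of_mul_isBigO_pow hg.continuousAt (hO.congr' hfg .rfl))
    refine ⟨q, hq, ?_⟩
    filter_upwards [hfg, hgq] with x hx hx'
    rw [hx, hx', pow_succ', mul_assoc]

theorem isBigO_deriv_of_isBigO_pow (hn : ∞ ≤ n) {j : ℕ} (hf : ContDiffAt ℝ n f 0)
    (hO : f =O[𝓝 0] fun x => x ^ (j + 1)) : deriv f =O[𝓝 0] fun x => x ^ j := by
  obtain ⟨g, hg, hfg⟩ := exists_eq_pow_mul hn (j + 1) hf hO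
  have hg1 : ContDiffAt ℝ 1 g 0 := hg.of_le (one_le_of_infty_le hn)
  have hderiv : deriv f =ᶠ[𝓝 0] fun x => x ^ j * ((j + 1) * g x + x * deriv g x) := by
    filter_upwards [hfg.eventually_nhds, hg1.eventually (by simp)] with x hx hgx
    have hmul := (hasDerivAt_pow (j + 1) x).mul (hgx.differentiableAt one_ne_zero).hasDerivAt
    rw [(hmul.congr_of_eventuallyEq hx).deriv]
    push_cast
    ring
  have hdg : ContinuousAt (deriv g) 0 :=
    (hg1.continuousAt_fderiv one_ne_zero).clm_apply continuousAt_const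
  have hfactor : ContinuousAt (fun x => (j + 1) * g x + x * deriv g x) 0 := by
    have := hg.continuousAt
    fun_prop
  refine hderiv.trans_isBigO ?_
  simpa using (isBigO_refl (fun x : ℝ => x ^ j) (𝓝 0)).mul (hfactor.tendsto.isBigO_one ℝ)

end OneVariable

section PartialDerivatives

variable {n : WithTop ℕ∞} {F : ℝ × ℝ → ℝ} {z : ℝ × ℝ}

theorem hasDerivAt_partialY (h : DifferentiableAt ℝ F z) :
    HasDerivAt (fun v => F (z.1, v)) (partialY F z) z.2 :=
  HasFDerivAt.comp_hasDerivAt (l := F) z.2 (f := fun v => (z.1, v)) h.hasFDerivAt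
    ((hasDerivAt_const z.2 z.1).prodMk (hasDerivAt_id z.2))

theorem contDiffAt_partialY (hn : ∞ ≤ n) (h : ContDiffAt ℝ n F z) :
    ContDiffAt ℝ n (partialY F) z :=
  (h.fderiv_right (add_one_le_of_infty_le hn)).clm_apply contDiffAt_const

theorem sign_partialY_eq_of_eq_add_sq {f : ℝ → ℝ} {Y : ℝ × ℝ → ℝ} (hF : DifferentiableAt ℝ F z)
    (hY : DifferentiableAt ℝ Y z) (hY' : 0 < partialY Y z)
    (h : ∀ᶠ w in 𝓝 z, F w = f w.1 + Y w ^ 2) :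
    SignType.sign (partialY F z) = SignType.sign (Y z) := by
  have hι : ContinuousAt (fun v : ℝ => (z.1, v)) z.2 := by fun_prop
  have hsq := ((hasDerivAt_partialY hY).pow 2).const_add (f z.1)
  rw [(hasDerivAt_partialY hF).unique (hsq.congr_of_eventuallyEq (hι.eventually h))]
  norm_num [sign_mul, sign_pos hY']

theorem partialY_partialY_eq (hn : ∞ ≤ n) (hF : ContDiffAt ℝ n F 0) {κ : ℝ}
    (hO : (fun v : ℝ => F (0, v) - F 0 - κ / 2 * v ^ 2) =O[𝓝 0] fun v => v ^ 3) :
    partialY (partialY F) 0 = κ := by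
  have hι : ContDiffAt ℝ n (fun v : ℝ => ((0 : ℝ), v)) 0 := by fun_prop
  have hrem : ContDiffAt ℝ n (fun v : ℝ => F (0, v) - F 0 - κ / 2 * v ^ 2) 0 :=
    ((ContDiffAt.comp (g := F) (0 : ℝ) hF hι).sub contDiffAt_const).sub (by fun_prop)
  have hderiv : deriv (fun v : ℝ => F (0, v) - F 0 - κ / 2 * v ^ 2) =ᶠ[𝓝 0]
      fun v => partialY F (0, v) - κ * v := by
    have hF1 := (hF.of_le (one_le_of_infty_le hn)).eventually (by simp)
    filter_upwards [hι.continuousAt.eventually hF1] with v hv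
    have hquad := (hasDerivAt_pow 2 v).const_mul (κ / 2)
    refine (((hasDerivAt_partialY (hv.differentiableAt one_ne_zero)).sub_const (F 0)).sub
      hquad).deriv.trans ?_
    norm_num
    ring
  have hrem' : HasDerivAt (fun v : ℝ => partialY F (0, v) - κ * v) 0 0 := by
    have hO' := hderiv.symm.trans_isBigO (isBigO_deriv_of_isBigO_pow (j := 2) hn hrem hO)
    have hO'' : (fun v : ℝ => partialY F (0, v) - κ * v) =O[𝓝 0] fun v => ‖v - 0‖ ^ 2 := by
      simpa using hO'.norm_right
    exact hO''.hasFDerivAt one_lt_two |>.hasDerivAt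
  have hpartial := hasDerivAt_partialY
    ((contDiffAt_partialY hn hF).differentiableAt (ne_zero_of_infty_le hn))
  have hsum := hrem'.add ((hasDerivAt_id (0 : ℝ)).const_mul κ)
  simp only [id, zero_add, mul_one] at hsum
  exact hpartial.unique (hsum.congr_of_eventuallyEq (Eventually.of_forall fun v => by simp))

end PartialDerivatives

section NormalCoordinates

variable {n : WithTop ℕ∞} {F : ℝ × ℝ → ℝ} {φ : ℝ → ℝ}

theorem exists_fiber_inverse (hn : n ≠ 0) {g : ℝ × ℝ → ℝ} (hg : ContDiffAt ℝ n g 0)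
    (hg0 : g 0 = 0) (hg' : partialY g 0 ≠ 0) :
    ∃ W : ℝ × ℝ → ℝ, ContDiffAt ℝ n W 0 ∧ ∀ᶠ z in 𝓝 (0 : ℝ × ℝ), W (z.1, g z) = z.2 := by
  let f : (ℝ × ℝ) × ℝ → ℝ := fun w => g (w.1.1, w.2) - w.1.2
  have hπ : ContDiffAt ℝ n (fun w : (ℝ × ℝ) × ℝ => (w.1.1, w.2)) 0 := by fun_prop
  have hf : ContDiffAt ℝ n f 0 :=
    (ContDiffAt.comp (g := g) (0 : (ℝ × ℝ) × ℝ) hg hπ).sub (by fun_prop)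
  have hf' : (fderiv ℝ f 0 ∘L .inr ℝ (ℝ × ℝ) ℝ) 1 = partialY g 0 := by
    have hι : HasDerivAt (fun y : ℝ => (((0 : ℝ × ℝ), y) : (ℝ × ℝ) × ℝ)) (0, 1) 0 :=
      (hasDerivAt_const _ _).prodMk (hasDerivAt_id _)
    have hcomp := HasFDerivAt.comp_hasDerivAt (0 : ℝ) (l := f)
      (hf.differentiableAt hn).hasFDerivAt hι
    have hgy : HasDerivAt (fun y : ℝ => g (0, y)) (partialY g 0) 0 :=
      hasDerivAt_partialY (hg.differentiableAt hn)
    exact hcomp.unique (hgy.sub_const 0)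
  have hinv : (fderiv ℝ f 0 ∘L .inr ℝ (ℝ × ℝ) ℝ).IsInvertible :=
    ⟨ContinuousLinearEquiv.unitsEquivAut ℝ (Units.mk0 _ hg'), ContinuousLinearMap.ext_ring (by
      rw [hf']; simp)⟩
  refine ⟨hf.implicitFunction hn hinv, hf.contDiffAt_implicitFunction hn hinv, ?_⟩
  have hlift : Tendsto (fun z : ℝ × ℝ => ((z.1, g z), z.2)) (𝓝 0) (𝓝 0) := by
    have hcont : ContinuousAt (fun z : ℝ × ℝ => ((z.1, g z), z.2)) 0 := by
      have := hg.continuousAt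
      fun_prop
    simpa [ContinuousAt, hg0, Prod.mk_zero_zero] using hcont
  filter_upwards [hlift.eventually (hf.eventually_apply_eq_iff_implicitFunction hn hinv)] with z hz
  exact hz.1 (by simp [f, hg0, Prod.mk_zero_zero])

theorem exists_inverse (hn : n ≠ 0) {X : ℝ → ℝ} (hX : ContDiffAt ℝ n X 0) (hX0 : X 0 = 0)
    (hX' : deriv X 0 ≠ 0) :
    ∃ U : ℝ → ℝ, ContDiffAt ℝ n U 0 ∧ ∀ᶠ x in 𝓝 0, U (X x) = x := by
  have hX₂ : ContDiffAt ℝ n (fun z : ℝ × ℝ => X z.2) 0 :=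
    ContDiffAt.comp (g := X) (0 : ℝ × ℝ) hX contDiffAt_snd
  have hpartial : partialY (fun z : ℝ × ℝ => X z.2) 0 = deriv X 0 :=
    (hasDerivAt_partialY (hX₂.differentiableAt hn)).deriv.symm
  obtain ⟨W, hW, hWX⟩ := exists_fiber_inverse hn hX₂ hX0 (hpartial ▸ hX')
  have hι : ContDiffAt ℝ n (fun x : ℝ => ((0 : ℝ), x)) 0 := by fun_prop
  exact ⟨fun x => W (0, x), ContDiffAt.comp (g := W) (0 : ℝ) hW hι, hι.continuousAt.eventually hWX⟩

theorem tendsto_graph (hφ : ContinuousAt φ 0) (hφ0 : φ 0 = 0) :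
    Tendsto (fun u => (u, φ u)) (𝓝 0) (𝓝 0) := by
  simpa [ContinuousAt, hφ0, Prod.mk_zero_zero] using continuousAt_id.prodMk hφ

theorem contDiffAt_of_partialY_eq_zero (hn : ∞ ≤ n) (hF : ContDiffAt ℝ n F 0)
    (hF' : partialY (partialY F) 0 ≠ 0) (hφ : ContinuousAt φ 0) (hφ0 : φ 0 = 0)
    (h : ∀ᶠ u in 𝓝 (0 : ℝ), partialY F (u, φ u) = 0) : ContDiffAt ℝ n φ 0 := by
  have hF0 : partialY F 0 = 0 := by simpa [hφ0, Prod.mk_zero_zero] using h.self_of_nhds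
  obtain ⟨W, hW, hWF⟩ := exists_fiber_inverse (ne_zero_of_infty_le hn)
    (contDiffAt_partialY hn hF) hF0 hF'
  have hι : ContDiffAt ℝ n (fun u : ℝ => (u, (0 : ℝ))) 0 := by fun_prop
  refine (ContDiffAt.comp (g := W) (f := fun u => (u, (0 : ℝ))) (0 : ℝ) hW
    hι).congr_of_eventuallyEq ?_
  filter_upwards [(tendsto_graph hφ hφ0).eventually hWF, h] with u hu hu'
  rw [Function.comp_apply, ← hu', hu]

theorem exists_pow_eq (hn : ∞ ≤ n) {f : ℝ → ℝ} (hf : ContDiffAt ℝ n f 0) {c : ℝ} (hc : 0 < c)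
    {m : ℕ} (hm : m ≠ 0) (hO : (fun x => f x - c * x ^ m) =O[𝓝 0] fun x => x ^ (m + 1)) :
    ∃ X : ℝ → ℝ, ContDiffAt ℝ n X 0 ∧ X 0 = 0 ∧ 0 < deriv X 0 ∧ ∀ᶠ x in 𝓝 0, X x ^ m = f x := by
  obtain ⟨q, hq, hfq⟩ := exists_eq_pow_mul hn (m + 1) (hf.sub (by fun_prop)) hO
  have hg : ContDiffAt ℝ n (fun x => c + x * q x) 0 := by fun_prop
  have hroot : ContDiffAt ℝ n (fun x => (c + x * q x) ^ (m⁻¹ : ℝ)) 0 :=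
    hg.rpow_const_of_ne (by simpa using hc.ne')
  have hX' : HasDerivAt (fun x => x * (c + x * q x) ^ (m⁻¹ : ℝ)) (c ^ (m⁻¹ : ℝ)) 0 := by
    have hn0 := ne_zero_of_infty_le hn
    exact ((hasDerivAt_id (0 : ℝ)).mul (hroot.differentiableAt hn0).hasDerivAt).congr_deriv
      (by simp)
  refine ⟨_, contDiffAt_id.mul hroot, by simp, hX'.deriv.symm ▸ Real.rpow_pos_of_pos hc _, ?_⟩
  have hpos : ∀ᶠ x in 𝓝 (0 : ℝ), 0 < c + x * q x :=
    hg.continuousAt.eventually (lt_mem_nhds (by simpa using hc))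
  filter_upwards [hpos, hfq] with x hx hfx
  rw [id, mul_pow, Real.rpow_inv_natCast_pow hx.le hm]
  linear_combination -hfx

theorem exists_eq_sq_mul (hn : ∞ ≤ n) (hF : ContDiffAt ℝ n F 0) (hφ : ContDiffAt ℝ n φ 0)
    (hφ0 : φ 0 = 0) (h : ∀ᶠ u in 𝓝 (0 : ℝ), partialY F (u, φ u) = 0) :
    ∃ G : ℝ × ℝ → ℝ, ContDiffAt ℝ n G 0 ∧
      ∀ᶠ z in 𝓝 (0 : ℝ × ℝ), F z = F (z.1, φ z.1) + (z.2 - φ z.1) ^ 2 * G z := by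
  have hφ₁ : ContDiffAt ℝ n (fun z : ℝ × ℝ => φ z.1) (0, 0) :=
    ContDiffAt.comp (g := φ) ((0, 0) : ℝ × ℝ) hφ contDiffAt_fst
  let f : ℝ × ℝ → ℝ := fun z => F (z.1, φ z.1 + z.2) - F (z.1, φ z.1)
  have hf : ContDiffAt ℝ n f (0, 0) := by
    refine ContDiffAt.sub
      (ContDiffAt.comp (g := F) (f := fun z : ℝ × ℝ => (z.1, φ z.1 + z.2)) (0, 0) ?_ (by fun_prop))
      (ContDiffAt.comp (g := F) (f := fun z : ℝ × ℝ => (z.1, φ z.1)) (0, 0) ?_ (by fun_prop)) <;>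
    simpa [hφ0, Prod.mk_zero_zero] using hF
  have hF1 := (hF.of_le (one_le_of_infty_le hn)).eventually (by simp)
  have hf1 := (hf.of_le (one_le_of_infty_le hn)).eventually (by simp)
  have hf' : ∀ᶠ u in 𝓝 (0 : ℝ), fderiv ℝ f (u, 0) (0, 1) = 0 := by
    have hι : ContinuousAt (fun u : ℝ => (u, (0 : ℝ))) 0 := by fun_prop
    filter_upwards [h, (tendsto_graph hφ.continuousAt hφ0).eventually hF1, hι.eventually hf1]
      with u hu hFu hfu
    have hFv := hasDerivAt_partialY (hFu.differentiableAt one_ne_zero)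
    have hshift := HasDerivAt.comp_const_add (φ u) 0 (f := fun v => F (u, v)) (by simpa using hFv)
    exact ((hasDerivAt_partialY (hfu.differentiableAt one_ne_zero)).unique
      (hshift.sub_const (F (u, φ u)))).trans hu
  have h2n : (2 : WithTop ℕ∞) ≤ n :=
    one_add_one_eq_two.symm.le.trans ((add_le_add_left (one_le_of_infty_le hn) 1).trans
      (add_one_le_of_infty_le hn))
  have hsq := eventually_eq_sq_mul_hadamardQuotient (hf.of_le h2n)
    (Eventually.of_forall fun u => by simp [f]) hf'
  have hG := contDiffAt_hadamardQuotient_zero (add_one_le_of_infty_le hn)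
    (contDiffAt_hadamardQuotient_zero (add_one_le_of_infty_le hn) hf)
  have hs : ContDiffAt ℝ n (fun z : ℝ × ℝ => (z.1, z.2 - φ z.1)) 0 :=
    contDiffAt_fst.prodMk (contDiffAt_snd.sub hφ₁)
  have hs0 : ((0 : ℝ × ℝ).1, (0 : ℝ × ℝ).2 - φ (0 : ℝ × ℝ).1) = (0, 0) := by simp [hφ0]
  refine ⟨_, ContDiffAt.comp (0 : ℝ × ℝ) (hs0.symm ▸ hG) hs, ?_⟩
  filter_upwards [hs.continuousAt.eventually (hs0.symm ▸ hsq)] with z hz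
  simp only [f, add_sub_cancel] at hz
  simp only [Function.comp_apply]
  linear_combination hz

theorem exists_sq_eq_sub (hn : ∞ ≤ n) (hF : ContDiffAt ℝ n F 0)
    (hF' : 0 < partialY (partialY F) 0) (hφ : ContDiffAt ℝ n φ 0) (hφ0 : φ 0 = 0)
    (h : ∀ᶠ u in 𝓝 (0 : ℝ), partialY F (u, φ u) = 0) :
    ∃ Y : ℝ × ℝ → ℝ, ContDiffAt ℝ n Y 0 ∧ Y 0 = 0 ∧ 0 < partialY Y 0 ∧
      ∀ᶠ z in 𝓝 (0 : ℝ × ℝ), Y z ^ 2 = F z - F (z.1, φ z.1) := by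
  have hn0 := ne_zero_of_infty_le hn
  obtain ⟨G, hG, hFG⟩ := exists_eq_sq_mul hn hF hφ hφ0 h
  have hι : ContDiffAt ℝ n (fun v : ℝ => ((0 : ℝ), v)) 0 := by fun_prop
  have hG0 : 0 < G 0 := by
    have hGι : DifferentiableAt ℝ (fun v : ℝ => G (0, v)) 0 :=
      (ContDiffAt.comp (g := G) (0 : ℝ) hG hι).differentiableAt hn0
    have hO := (isBigO_refl (fun v : ℝ => v ^ 2) (𝓝 0)).mul hGι.isBigO_sub
    have hFvv : partialY (partialY F) 0 = 2 * G 0 := by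
      refine partialY_partialY_eq hn hF ((hO.congr' ?_ ?_).trans (isBigO_refl _ _))
      · filter_upwards [hι.continuousAt.eventually hFG] with v hv
        simp only [hφ0, sub_zero, Prod.mk_zero_zero] at hv ⊢
        linear_combination -hv
      · exact Eventually.of_forall fun v => by ring
    linarith
  have hroot : ContDiffAt ℝ n (fun z => √(G z)) 0 := hG.sqrt hG0.ne'
  have hφ₁ : ContDiffAt ℝ n (fun z : ℝ × ℝ => φ z.1) 0 :=
    ContDiffAt.comp (g := φ) (0 : ℝ × ℝ) hφ contDiffAt_fst
  have hY : ContDiffAt ℝ n (fun z : ℝ × ℝ => (z.2 - φ z.1) * √(G z)) 0 :=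
    (contDiffAt_snd.sub hφ₁).mul hroot
  have hY' : partialY (fun z : ℝ × ℝ => (z.2 - φ z.1) * √(G z)) 0 = √(G 0) := by
    refine (hasDerivAt_partialY (hY.differentiableAt hn0)).unique ?_
    have hprod := ((hasDerivAt_id (0 : ℝ)).sub_const (φ 0)).mul
      (hasDerivAt_partialY (hroot.differentiableAt hn0))
    exact hprod.congr_deriv (by simp [hφ0, Prod.mk_zero_zero])
  refine ⟨_, hY, by simp [hφ0], hY'.symm ▸ Real.sqrt_pos.2 hG0, ?_⟩
  filter_upwards [hFG, hG.continuousAt.eventually (lt_mem_nhds hG0)] with z hz hGz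
  rw [mul_pow, Real.sq_sqrt hGz.le]
  linear_combination -hz

/-- At the point `z`, the functions `X (u)` and `Y (u, v)` are coordinates in which the Hamiltonian
is `F = X ^ (2 * p) + Y ^ 2`, with inverse `(x, y) ↦ (U x, V (x, y))`. The sign condition fixes
the orientation: the flow of `F` moves to the right where `Y` is positive. -/
structure NormalCoordinatesAt (F : ℝ × ℝ → ℝ) (p : ℕ) (X : ℝ → ℝ) (Y : ℝ × ℝ → ℝ) (U : ℝ → ℝ)
    (V : ℝ × ℝ → ℝ) (z : ℝ × ℝ) : Prop where
  contDiffAt : ContDiffAt ℝ 1 F z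
  contDiffAt_fst : ContDiffAt ℝ 1 X z.1
  continuousAt_snd : ContinuousAt Y z
  differentiableAt_inv_fst : DifferentiableAt ℝ U (X z.1)
  deriv_fst_pos : 0 < deriv X z.1
  eq_pow_add_sq : F z = X z.1 ^ (2 * p) + Y z ^ 2
  inv_fst : U (X z.1) = z.1
  inv_snd : V (X z.1, Y z) = z.2
  sign_partialY : SignType.sign (partialY F z) = SignType.sign (Y z)

theorem eventually_normalCoordinatesAt (hn : ∞ ≤ n) {p : ℕ} {X U : ℝ → ℝ} {Y W : ℝ × ℝ → ℝ}
    (hF : ContDiffAt ℝ n F 0) (hX : ContDiffAt ℝ n X 0) (hY : ContDiffAt ℝ n Y 0)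
    (hU : ContDiffAt ℝ n U 0) (hX0 : X 0 = 0) (hX' : 0 < deriv X 0) (hY' : 0 < partialY Y 0)
    (hFXY : ∀ᶠ z in 𝓝 (0 : ℝ × ℝ), F z = X z.1 ^ (2 * p) + Y z ^ 2)
    (hUX : ∀ᶠ x in 𝓝 0, U (X x) = x) (hWY : ∀ᶠ z in 𝓝 (0 : ℝ × ℝ), W (z.1, Y z) = z.2) :
    ∀ᶠ z in 𝓝 (0 : ℝ × ℝ), NormalCoordinatesAt F p X Y U (fun w => W (U w.1, w.2)) z := by
  have h1n := one_le_of_infty_le hn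
  have hfst : Tendsto (Prod.fst : ℝ × ℝ → ℝ) (𝓝 0) (𝓝 0) := continuous_fst.tendsto 0
  have hX1 := (hX.of_le h1n).eventually (by simp)
  have hU1 : ∀ᶠ x in 𝓝 0, ContDiffAt ℝ 1 U (X x) :=
    hX.continuousAt.eventually (by rw [hX0]; exact (hU.of_le h1n).eventually (by simp))
  have hX1' : ∀ᶠ x in 𝓝 0, 0 < deriv X x :=
    (((hX.of_le h1n).continuousAt_fderiv one_ne_zero).clm_apply continuousAt_const).eventually
      (lt_mem_nhds hX')
  filter_upwards [(hF.of_le h1n).eventually (by simp), (hY.of_le h1n).eventually (by simp),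
    (contDiffAt_partialY hn hY).continuousAt.eventually (lt_mem_nhds hY'), hFXY.eventually_nhds,
    hWY, hfst.eventually hX1, hfst.eventually hU1, hfst.eventually hX1', hfst.eventually hUX]
    with z hFz hYz hYz' hFXYz hWYz hXz hUz hXz' hUXz
  exact
    { contDiffAt := hFz
      contDiffAt_fst := hXz
      continuousAt_snd := hYz.continuousAt
      differentiableAt_inv_fst := hUz.differentiableAt one_ne_zero
      deriv_fst_pos := hXz'
      eq_pow_add_sq := hFXYz.self_of_nhds
      inv_fst := hUXz
      inv_snd := by rwa [hUXz]
      sign_partialY := sign_partialY_eq_of_eq_add_sq (f := fun u => X u ^ (2 * p))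
        (hFz.differentiableAt one_ne_zero) (hYz.differentiableAt one_ne_zero) hYz' hFXYz }

theorem exists_normalCoordinates (hn : ∞ ≤ n) (hF : ContDiffAt ℝ n F 0)
    (hF' : 0 < partialY (partialY F) 0) {p : ℕ} (hp : 1 ≤ p) (hord : HasCenterOrder F p) :
    ∃ (X : ℝ → ℝ) (Y : ℝ × ℝ → ℝ) (U : ℝ → ℝ) (V : ℝ × ℝ → ℝ),
      ContDiffAt ℝ n U 0 ∧ ContDiffAt ℝ n V 0 ∧ U 0 = 0 ∧ V 0 = 0 ∧
      ∀ᶠ z in 𝓝 (0 : ℝ × ℝ), NormalCoordinatesAt F p X Y U V z := by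
  obtain ⟨φ, hφ_smooth, hφO, hφ', c, hc, hcO⟩ := hord
  have hφ0 : φ 0 = 0 := by simpa using hφO.eq_zero_imp.self_of_nhds
  have hφ : ContDiffAt ℝ n φ 0 :=
    contDiffAt_of_partialY_eq_zero hn hF hF'.ne' hφ_smooth.continuousAt hφ0 hφ'
  have hFφ : ContDiffAt ℝ n (fun u => F (u, φ u)) 0 := by
    refine ContDiffAt.comp (g := F) (f := fun u => (u, φ u)) (0 : ℝ) ?_ (contDiffAt_id.prodMk hφ)
    simpa [hφ0, Prod.mk_zero_zero] using hF
  obtain ⟨X, hX, hX0, hX', hXF⟩ := exists_pow_eq hn hFφ hc (m := 2 * p) (by omega) hcO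
  obtain ⟨Y, hY, hY0, hY', hYF⟩ := exists_sq_eq_sub hn hF hF' hφ hφ0 hφ'
  obtain ⟨U, hU, hUX⟩ := exists_inverse (ne_zero_of_infty_le hn) hX hX0 hX'.ne'
  obtain ⟨W, hW, hWY⟩ := exists_fiber_inverse (ne_zero_of_infty_le hn) hY hY0 hY'.ne'
  have hU0 : U 0 = 0 := by simpa [hX0] using hUX.self_of_nhds
  have hW0 : W 0 = 0 := by simpa [hY0, Prod.mk_zero_zero] using hWY.self_of_nhds
  have hUfst : ContDiffAt ℝ n (fun w : ℝ × ℝ => (U w.1, w.2)) 0 :=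
    (ContDiffAt.comp (g := U) (0 : ℝ × ℝ) hU contDiffAt_fst).prodMk contDiffAt_snd
  have hV : ContDiffAt ℝ n (fun w : ℝ × ℝ => W (U w.1, w.2)) 0 := by
    refine ContDiffAt.comp (g := W) (0 : ℝ × ℝ) ?_ hUfst
    simpa [hU0, Prod.mk_zero_zero] using hW
  have hFXY : ∀ᶠ z in 𝓝 (0 : ℝ × ℝ), F z = X z.1 ^ (2 * p) + Y z ^ 2 := by
    filter_upwards [hYF, (continuous_fst.tendsto (0 : ℝ × ℝ)).eventually hXF] with z hz hz'
    rw [hz, hz', add_sub_cancel]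
  exact ⟨X, Y, U, _, hU, hV, hU0, by simpa [hU0, Prod.mk_zero_zero] using hW0,
    eventually_normalCoordinatesAt hn hF hX hY hU hX0 hX' hY' hFXY hUX hWY⟩

end NormalCoordinates

section ClockwiseLoop

theorem injOn_Ico_add_of_periodic {α : Type*} {f : ℝ → α} {T : ℝ} (hf : f.Periodic T) (hT : 0 < T)
    (hinj : InjOn f (Ico 0 T)) (a : ℝ) : InjOn f (Ico a (a + T)) := by
  intro s hs t ht hst
  have hmem : ∀ r, toIcoMod hT 0 r ∈ Ico 0 T := fun r => by
    simpa only [zero_add] using toIcoMod_mem_Ico hT 0 r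
  have hval : ∀ r, f (toIcoMod hT 0 r) = f r := fun r => by
    rw [toIcoMod, hf.sub_zsmul_eq]
  have hmod : toIcoMod hT 0 s = toIcoMod hT 0 t :=
    hinj (hmem s) (hmem t) (by rw [hval, hval, hst])
  have hmod' := (toIcoMod_inj hT (c := a)).2 ((toIcoMod_inj hT).1 hmod)
  rwa [(toIcoMod_eq_self hT).2 hs, (toIcoMod_eq_self hT).2 ht] at hmod'

theorem Icc_subset_of_Ioo_subset_of_isClosed {a b : ℝ} {S : Set ℝ} (hab : a < b)
    (hS : IsClosed S) (h : Ioo a b ⊆ S) : Icc a b ⊆ S := by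
  rw [← closure_Ioo hab.ne]
  exact closure_minimal h hS

theorem pos_of_sign_deriv_eq {x y : ℝ → ℝ} {a b : ℝ} (hx : ContinuousOn x (Icc a b))
    (hy : ContinuousOn y (Ioo a b))
    (hsign : ∀ t ∈ Ioo a b, SignType.sign (deriv x t) = SignType.sign (y t)) (hab : a < b)
    (hlt : x a < x b) (hne : ∀ t ∈ Ioo a b, y t ≠ 0) : ∀ t ∈ Ioo a b, 0 < y t := by
  intro s hs
  by_contra! hsneg
  have hneg : ∀ t ∈ Ioo a b, y t < 0 := fun t ht => by
    by_contra! hpos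
    obtain ⟨r, hr, hr0⟩ := isPreconnected_Ioo.intermediate_value hs ht hy ⟨hsneg, hpos⟩
    exact hne r hr hr0
  have hanti : StrictAntiOn x (Icc a b) := by
    refine strictAntiOn_of_deriv_neg (convex_Icc a b) hx fun t ht => ?_
    rw [interior_Icc] at ht
    rw [← sign_eq_neg_one_iff, hsign t ht, sign_neg (hneg t ht)]
  exact (hanti (left_mem_Icc.2 hab.le) (right_mem_Icc.2 hab.le) hab).not_gt hlt

theorem neg_of_sign_deriv_eq {x y : ℝ → ℝ} {a b : ℝ} (hx : ContinuousOn x (Icc a b))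
    (hy : ContinuousOn y (Ioo a b))
    (hsign : ∀ t ∈ Ioo a b, SignType.sign (deriv x t) = SignType.sign (y t)) (hab : a < b)
    (hlt : x b < x a) (hne : ∀ t ∈ Ioo a b, y t ≠ 0) : ∀ t ∈ Ioo a b, y t < 0 := by
  have hpos := pos_of_sign_deriv_eq hx.neg hy.neg
    (fun t ht => by rw [deriv.neg, Left.sign_neg, hsign t ht, Pi.neg_apply, Left.sign_neg])
    hab (neg_lt_neg hlt) (fun t ht => neg_ne_zero.2 (hne t ht))
  exact fun t ht => neg_pos.1 (hpos t ht)

/-- The curve `t ↦ (x t, y t)`, run through once while `t` runs through `[0, T)`, is a closed curve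
on the level `x ^ (2 * p) + y ^ 2 = ρ ^ (2 * p)`. The sign condition says that it moves to the right
in the upper half plane and to the left in the lower one. -/
structure IsClockwiseLoop (p : ℕ) (ρ : ℝ) (x y : ℝ → ℝ) (T : ℝ) : Prop where
  contDiff_fst : ContDiff ℝ 1 x
  continuous_snd : Continuous y
  period_pos : 0 < T
  periodic_fst : x.Periodic T
  periodic_snd : y.Periodic T
  injOn : InjOn (fun t => (x t, y t)) (Ico 0 T)
  level : ∀ t, x t ^ (2 * p) + y t ^ 2 = ρ ^ (2 * p)
  sign_deriv : ∀ t, SignType.sign (deriv x t) = SignType.sign (y t)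

namespace IsClockwiseLoop

variable {p : ℕ} {ρ : ℝ} {x y : ℝ → ℝ} {T : ℝ}

theorem snd_eq_zero_iff (hl : IsClockwiseLoop p ρ x y T) {t : ℝ} : y t = 0 ↔ deriv x t = 0 := by
  rw [← sign_eq_zero_iff, ← hl.sign_deriv, sign_eq_zero_iff]

theorem pow_fst_le (hl : IsClockwiseLoop p ρ x y T) (t : ℝ) : x t ^ (2 * p) ≤ ρ ^ (2 * p) := by
  linarith [hl.level t, sq_nonneg (y t)]

theorem abs_fst_le (hl : IsClockwiseLoop p ρ x y T) (hp : 1 ≤ p) (hρ : 0 < ρ) (t : ℝ) :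
    |x t| ≤ ρ := by
  have hpow := hl.pow_fst_le t
  rw [← (even_two_mul p).pow_abs] at hpow
  exact (pow_le_pow_iff_left₀ (abs_nonneg _) hρ.le (by omega)).1 hpow

theorem fst_eq_or_eq_neg (hl : IsClockwiseLoop p ρ x y T) (hp : 1 ≤ p) (hρ : 0 < ρ) {t : ℝ}
    (ht : y t = 0) : x t = ρ ∨ x t = -ρ := by
  have hpow : |x t| ^ (2 * p) = ρ ^ (2 * p) := by
    simpa [ht, (even_two_mul p).pow_abs] using hl.level t
  exact (abs_eq hρ.le).1 ((pow_left_inj₀ (abs_nonneg _) hρ.le (by omega)).1 hpow)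

theorem exists_fst_ne (hl : IsClockwiseLoop p ρ x y T) (a : ℝ) : ∃ t, x t ≠ a := by
  by_contra! hconst
  have hy : ∀ t, y t = 0 := fun t => hl.snd_eq_zero_iff.2 (by simp [funext hconst])
  have hT := hl.period_pos
  have hhalf : T / 2 = 0 := hl.injOn ⟨by linarith, by linarith⟩ ⟨le_rfl, hT⟩ (by simp [hconst, hy])
  linarith

theorem exists_turning_times (hl : IsClockwiseLoop p ρ x y T) (hp : 1 ≤ p) (hρ : 0 < ρ) :
    ∃ t₀ t₁, t₀ < t₁ ∧ t₁ < t₀ + T ∧ x t₀ = ρ ∧ y t₀ = 0 ∧ x t₁ = -ρ ∧ y t₁ = 0 := by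
  have hT := hl.period_pos
  have hx := hl.contDiff_fst.continuous
  obtain ⟨t₀, -, ht₀⟩ := isCompact_Icc.exists_isMaxOn (nonempty_Icc.2 hT.le) hx.continuousOn
  obtain ⟨t₂, -, ht₂⟩ := isCompact_Icc.exists_isMinOn (nonempty_Icc.2 hT.le) hx.continuousOn
  obtain ⟨t₁, ht₁, hx₁⟩ := hl.periodic_fst.exists_mem_Ico hT t₂ t₀
  have hmax : ∀ t, x t ≤ x t₀ := fun t => by
    obtain ⟨s, hs, hst⟩ := hl.periodic_fst.exists_mem_Ico₀ hT t
    exact hst.trans_le (ht₀ (Ico_subset_Icc_self hs))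
  have hmin : ∀ t, x t₁ ≤ x t := fun t => by
    obtain ⟨s, hs, hst⟩ := hl.periodic_fst.exists_mem_Ico₀ hT t
    rw [hst, ← hx₁]
    exact ht₂ (Ico_subset_Icc_self hs)
  have hlt : x t₁ < x t₀ := by
    obtain ⟨t, ht⟩ := hl.exists_fst_ne (x t₀)
    exact (hmin t).trans_lt ((hmax t).lt_of_ne ht)
  have hy₀ : y t₀ = 0 := hl.snd_eq_zero_iff.2 (IsLocalMax.deriv_eq_zero (.of_forall hmax))
  have hy₁ : y t₁ = 0 := hl.snd_eq_zero_iff.2 (IsLocalMin.deriv_eq_zero (.of_forall hmin))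
  have hne : t₀ ≠ t₁ := fun he => hlt.ne (by rw [he])
  refine ⟨t₀, t₁, ht₁.1.lt_of_ne hne, ht₁.2, ?_, hy₀, ?_, hy₁⟩ <;>
    rcases hl.fst_eq_or_eq_neg hp hρ hy₀ with h₀ | h₀ <;>
    rcases hl.fst_eq_or_eq_neg hp hρ hy₁ with h₁ | h₁ <;> linarith

theorem exists_arcs (hl : IsClockwiseLoop p ρ x y T) (hp : 1 ≤ p) (hρ : 0 < ρ) :
    ∃ t₀ t₁, t₀ < t₁ ∧ t₁ < t₀ + T ∧ x t₀ = ρ ∧ x t₁ = -ρ ∧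
      (∀ t ∈ Icc t₀ t₁, y t ≤ 0) ∧ ∀ t ∈ Icc t₁ (t₀ + T), 0 ≤ y t := by
  obtain ⟨t₀, t₁, h01, h1T, hx₀, hy₀, hx₁, hy₁⟩ := hl.exists_turning_times hp hρ
  have hinj := injOn_Ico_add_of_periodic (f := fun t => (x t, y t))
    (fun t => by simp only [hl.periodic_fst t, hl.periodic_snd t]) hl.period_pos hl.injOn t₀
  have hne : ∀ t ∈ Ioo t₀ (t₀ + T), t ≠ t₁ → y t ≠ 0 := by
    intro t ht hne hy
    rcases hl.fst_eq_or_eq_neg hp hρ hy with hx | hx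
    · exact ht.1.ne' (hinj ⟨ht.1.le, ht.2⟩ ⟨le_rfl, h01.trans h1T⟩
        (by simp only [hx, hy, hx₀, hy₀]))
    · exact hne (hinj ⟨ht.1.le, ht.2⟩ ⟨h01.le, h1T⟩ (by simp only [hx, hy, hx₁, hy₁]))
  have hx := hl.contDiff_fst.continuous
  have hy := hl.continuous_snd
  refine ⟨t₀, t₁, h01, h1T, hx₀, hx₁,
    Icc_subset_of_Ioo_subset_of_isClosed h01 (isClosed_le hy continuous_const) fun t ht => ?_,
    Icc_subset_of_Ioo_subset_of_isClosed h1T (isClosed_le continuous_const hy) fun t ht => ?_⟩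
  · exact (neg_of_sign_deriv_eq hx.continuousOn hy.continuousOn (fun t _ => hl.sign_deriv t) h01
      (by linarith) (fun t ht => hne t ⟨ht.1, ht.2.trans h1T⟩ ht.2.ne) t ht).le
  · exact (pos_of_sign_deriv_eq hx.continuousOn hy.continuousOn (fun t _ => hl.sign_deriv t) h1T
      (by rw [hl.periodic_fst]; linarith)
      (fun t ht => hne t ⟨h01.trans ht.1, ht.2⟩ ht.1.ne') t ht).le

theorem sqrt_eq_abs_snd (hl : IsClockwiseLoop p ρ x y T) (t : ℝ) :
    √(ρ ^ (2 * p) - x t ^ (2 * p)) = |y t| := by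
  rw [← hl.level t, add_sub_cancel_left, Real.sqrt_sq_eq_abs]

theorem integral_arc (hl : IsClockwiseLoop p ρ x y T) (hp : 1 ≤ p) (hρ : 0 < ρ) {f : ℝ × ℝ → ℝ}
    {g : ℝ → ℝ} (hg : ContinuousOn g (Icc (-ρ) ρ)) {a b : ℝ} (hab : a ≤ b)
    (hfg : ∀ t ∈ Icc a b, f (x t, y t) = g (x t)) :
    ∫ t in a..b, f (x t, y t) * deriv x t = ∫ s in x a..x b, g s := by
  have hx : ∀ t, HasDerivAt x (deriv x t) t := fun t =>
    (hl.contDiff_fst.differentiable one_ne_zero t).hasDerivAt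
  rw [← intervalIntegral.integral_comp_mul_deriv'' hl.contDiff_fst.continuous.continuousOn
    (fun t _ => (hx t).hasDerivWithinAt) (hl.contDiff_fst.continuous_deriv_one).continuousOn
    (hg.mono (image_subset_iff.2 fun t _ => abs_le.1 (hl.abs_fst_le hp hρ t)))]
  refine intervalIntegral.integral_congr fun t ht => ?_
  rw [uIcc_of_le hab] at ht
  simp only [Function.comp_apply, hfg t ht]

theorem integral_eq (hl : IsClockwiseLoop p ρ x y T) (hp : 1 ≤ p) (hρ : 0 < ρ) {f : ℝ × ℝ → ℝ}
    (hf : ContinuousOn f {z | z.1 ^ (2 * p) + z.2 ^ 2 = ρ ^ (2 * p)}) :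
    ∫ t in (0 : ℝ)..T, f (x t, y t) * deriv x t =
      ∫ s in -ρ..ρ, (f (s, √(ρ ^ (2 * p) - s ^ (2 * p))) -
        f (s, -√(ρ ^ (2 * p) - s ^ (2 * p)))) := by
  obtain ⟨t₀, t₁, h01, h1T, hx₀, hx₁, hneg, hpos⟩ := hl.exists_arcs hp hρ
  have hsq : ∀ s ∈ Icc (-ρ) ρ,
      s ^ (2 * p) + √(ρ ^ (2 * p) - s ^ (2 * p)) ^ 2 = ρ ^ (2 * p) := fun s hs => by
    have hle : s ^ (2 * p) ≤ ρ ^ (2 * p) := by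
      rw [← (even_two_mul p).pow_abs]
      exact pow_le_pow_left₀ (abs_nonneg _) (abs_le.2 hs) _
    rw [Real.sq_sqrt (sub_nonneg.2 hle), add_sub_cancel]
  have hupper : ContinuousOn (fun s => f (s, √(ρ ^ (2 * p) - s ^ (2 * p)))) (Icc (-ρ) ρ) :=
    hf.comp (f := fun s => (s, √(ρ ^ (2 * p) - s ^ (2 * p)))) (by fun_prop) hsq
  have hlower : ContinuousOn (fun s => f (s, -√(ρ ^ (2 * p) - s ^ (2 * p)))) (Icc (-ρ) ρ) :=
    hf.comp (f := fun s => (s, -√(ρ ^ (2 * p) - s ^ (2 * p)))) (by fun_prop) fun s hs => by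
      simpa only [mem_ofPred_eq, neg_sq] using hsq s hs
  have hcont : Continuous fun t => f (x t, y t) * deriv x t :=
    (hf.comp_continuous (hl.contDiff_fst.continuous.prodMk hl.continuous_snd) hl.level).mul
      hl.contDiff_fst.continuous_deriv_one
  have hper : Function.Periodic (fun t => f (x t, y t) * deriv x t) T := fun t => by
    simp only [hl.periodic_fst t, hl.periodic_snd t, ← deriv_comp_add_const, funext hl.periodic_fst]
  have hlow : ∫ t in t₀..t₁, f (x t, y t) * deriv x t = _ :=
    hl.integral_arc hp hρ hlower h01.le fun t ht => by
      rw [hl.sqrt_eq_abs_snd, abs_of_nonpos (hneg t ht), neg_neg]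
  have hup : ∫ t in t₁..t₀ + T, f (x t, y t) * deriv x t = _ :=
    hl.integral_arc hp hρ hupper h1T.le fun t ht => by
      rw [hl.sqrt_eq_abs_snd, abs_of_nonneg (hpos t ht)]
  have hle : -ρ ≤ ρ := by linarith
  rw [← zero_add T, hper.intervalIntegral_add_eq 0 t₀,
    ← intervalIntegral.integral_add_adjacent_intervals (hcont.intervalIntegrable t₀ t₁)
      (hcont.intervalIntegrable t₁ (t₀ + T)), hlow, hup, hl.periodic_fst, hx₀, hx₁,
    intervalIntegral.integral_symm, intervalIntegral.integral_sub
      (hupper.intervalIntegrable_of_Icc hle) (hlower.intervalIntegrable_of_Icc hle), neg_add_eq_sub]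

end IsClockwiseLoop

end ClockwiseLoop

namespace IsPeriodicOrbit

variable {F : ℝ × ℝ → ℝ} {h : ℝ} {γ : ℝ → ℝ × ℝ} {T : ℝ}

theorem continuous (hγ : IsPeriodicOrbit F h γ T) : Continuous γ :=
  continuous_iff_continuousAt.2 fun t => (hγ.flow t).continuousAt

theorem hasDerivAt_fst (hγ : IsPeriodicOrbit F h γ T) (t : ℝ) :
    HasDerivAt (fun t => (γ t).1) (partialY F (γ t)) t :=
  (hasFDerivAt_fst (𝕜 := ℝ) (p := γ t)).comp_hasDerivAt t (hγ.flow t)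

theorem continuous_partialX {R : ℝ × ℝ → ℝ} (hγ : IsPeriodicOrbit F h γ T)
    (hR : ∀ t, ContDiffAt ℝ 1 R (γ t)) : Continuous fun t => partialX R (γ t) :=
  continuous_iff_continuousAt.2 fun t => ContinuousAt.comp (g := partialX R)
    (((hR t).continuousAt_fderiv one_ne_zero).clm_apply continuousAt_const)
    hγ.continuous.continuousAt

theorem continuous_partialY {R : ℝ × ℝ → ℝ} (hγ : IsPeriodicOrbit F h γ T)
    (hR : ∀ t, ContDiffAt ℝ 1 R (γ t)) : Continuous fun t => partialY R (γ t) :=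
  continuous_iff_continuousAt.2 fun t => ContinuousAt.comp (g := partialY R)
    (((hR t).continuousAt_fderiv one_ne_zero).clm_apply continuousAt_const)
    hγ.continuous.continuousAt

theorem contDiff_fst (hγ : IsPeriodicOrbit F h γ T) (hF : ∀ t, ContDiffAt ℝ 1 F (γ t)) :
    ContDiff ℝ 1 fun t => (γ t).1 := by
  refine contDiff_one_iff_deriv.2 ⟨fun t => (hγ.hasDerivAt_fst t).differentiableAt, ?_⟩
  simpa only [funext fun t => (hγ.hasDerivAt_fst t).deriv] using hγ.continuous_partialY hF

theorem isClockwiseLoop {p : ℕ} {ρ : ℝ} {X U : ℝ → ℝ} {Y V : ℝ × ℝ → ℝ}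
    (hγ : IsPeriodicOrbit F (ρ ^ (2 * p)) γ T)
    (hN : ∀ t, NormalCoordinatesAt F p X Y U V (γ t)) :
    IsClockwiseLoop p ρ (fun t => X (γ t).1) (fun t => Y (γ t)) T where
  contDiff_fst := contDiff_iff_contDiffAt.2 fun t =>
    ContDiffAt.comp t (hN t).contDiffAt_fst
      (hγ.contDiff_fst fun t => (hN t).contDiffAt).contDiffAt
  continuous_snd := continuous_iff_continuousAt.2 fun t =>
    (hN t).continuousAt_snd.comp hγ.continuous.continuousAt
  period_pos := hγ.period_pos
  periodic_fst t := by simp only [hγ.closed t]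
  periodic_snd t := by simp only [hγ.closed t]
  injOn s hs t ht hst := by
    obtain ⟨hX, hY⟩ := Prod.mk.inj hst
    refine hγ.simple hs ht (Prod.ext ?_ ?_)
    · rw [← (hN s).inv_fst, hX, (hN t).inv_fst]
    · rw [← (hN s).inv_snd, hX, hY, (hN t).inv_snd]
  level t := by rw [← (hN t).eq_pow_add_sq, hγ.level]
  sign_deriv t := by
    have hX := ((hN t).contDiffAt_fst.differentiableAt one_ne_zero).hasDerivAt
    have hderiv : deriv (fun t => X (γ t).1) t = _ := (hX.comp t (hγ.hasDerivAt_fst t)).deriv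
    rw [hderiv, sign_mul, sign_pos (hN t).deriv_fst_pos, one_mul,
      (hN t).sign_partialY]

end IsPeriodicOrbit

section LineIntegral

/-- The primitive `∫₀^v p(u, s) ds` of `p` in the second variable. Subtracting the differential of
this function from `q du - p dv` leaves a one-form without a `dv` term. -/
def primitiveY (p : ℝ × ℝ → ℝ) (z : ℝ × ℝ) : ℝ := ∫ s in (0 : ℝ)..z.2, p (z.1, s)

/-- The coefficient `K` of the one-form `K du` that differs from `q du - p dv` by the exact form
`d (primitiveY p)`. -/
def reducedForm (p q : ℝ × ℝ → ℝ) (z : ℝ × ℝ) : ℝ := q z + partialX (primitiveY p) z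

theorem primitiveY_eq_integral_unit (p : ℝ × ℝ → ℝ) (z : ℝ × ℝ) :
    primitiveY p z = ∫ t in (0 : ℝ)..1, z.2 * p (z.1, t * z.2) := by
  have hscale := intervalIntegral.mul_integral_comp_mul_right (a := 0) (b := 1)
    (f := fun s => p (z.1, s)) z.2
  rw [zero_mul, one_mul] at hscale
  rw [intervalIntegral.integral_const_mul, hscale, primitiveY]

theorem hasDerivAt_primitiveY {p : ℝ × ℝ → ℝ} {η : ℝ} (hp : ContinuousOn p (Metric.ball 0 η))
    {z : ℝ × ℝ} (hz : z ∈ Metric.ball (0 : ℝ × ℝ) η) :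
    HasDerivAt (fun v => primitiveY p (z.1, v)) (p z) z.2 := by
  rw [← Prod.mk_zero_zero, ← ball_prod_same] at hz hp
  have hslice : ContinuousOn (fun s => p (z.1, s)) (Metric.ball 0 η) :=
    hp.comp (f := fun s => (z.1, s)) (by fun_prop) fun s hs => mk_mem_prod hz.1 hs
  have h0 : (0 : ℝ) ∈ Metric.ball 0 η := Metric.mem_ball_self (Metric.pos_of_mem_ball hz.2)
  have hsub : uIcc 0 z.2 ⊆ Metric.ball 0 η :=
    (convex_ball (0 : ℝ) η).ordConnected.uIcc_subset h0 hz.2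
  exact intervalIntegral.integral_hasDerivAt_right (hslice.mono hsub).intervalIntegrable
    (hslice.stronglyMeasurableAtFilter Metric.isOpen_ball z.2 hz.2)
    (hslice.continuousAt (Metric.isOpen_ball.mem_nhds hz.2))

theorem IsPeriodicOrbit.integral_bracket_eq_zero {F R : ℝ × ℝ → ℝ} {h : ℝ} {γ : ℝ → ℝ × ℝ}
    {T : ℝ} (hγ : IsPeriodicOrbit F h γ T) (hF : ∀ t, ContDiffAt ℝ 1 F (γ t))
    (hR : ∀ t, ContDiffAt ℝ 1 R (γ t)) :
    ∫ t in (0 : ℝ)..T,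
      (partialX R (γ t) * partialY F (γ t) - partialY R (γ t) * partialX F (γ t)) = 0 := by
  have hderiv : ∀ t, HasDerivAt (fun t => R (γ t))
      (partialX R (γ t) * partialY F (γ t) - partialY R (γ t) * partialX F (γ t)) t := fun t => by
    have hdR := ((hR t).differentiableAt one_ne_zero).hasFDerivAt.comp_hasDerivAt t (hγ.flow t)
    refine hdR.congr_deriv ?_
    have hbasis : ((partialY F (γ t), -partialX F (γ t)) : ℝ × ℝ) =
        partialY F (γ t) • (1, 0) + (-partialX F (γ t)) • (0, 1) := by simp
    rw [hbasis, map_add, map_smul, map_smul]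
    simp only [smul_eq_mul, partialX, partialY]
    ring
  have hcont : Continuous fun t =>
      partialX R (γ t) * partialY F (γ t) - partialY R (γ t) * partialX F (γ t) :=
    ((hγ.continuous_partialX hR).mul (hγ.continuous_partialY hF)).sub
      ((hγ.continuous_partialY hR).mul (hγ.continuous_partialX hF))
  rw [intervalIntegral.integral_eq_sub_of_hasDerivAt (fun t _ => hderiv t)
    (hcont.intervalIntegrable 0 T), ← zero_add T, hγ.closed, sub_self]

theorem IsPeriodicOrbit.integral_eq_integral_reducedForm {F p q : ℝ × ℝ → ℝ} {h : ℝ}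
    {γ : ℝ → ℝ × ℝ} {T : ℝ} (hγ : IsPeriodicOrbit F h γ T) {η : ℝ}
    (hη : ∀ t, γ t ∈ Metric.ball (0 : ℝ × ℝ) η) (hF : ∀ t, ContDiffAt ℝ 1 F (γ t))
    (hp : ContinuousOn p (Metric.ball 0 η)) (hq : ContinuousOn q (Metric.ball 0 η))
    (hR : ∀ t, ContDiffAt ℝ 1 (primitiveY p) (γ t)) :
    ∫ t in (0 : ℝ)..T, (partialY F (γ t) * q (γ t) + partialX F (γ t) * p (γ t)) =
      ∫ t in (0 : ℝ)..T, reducedForm p q (γ t) * partialY F (γ t) := by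
  have hRY : ∀ t, partialY (primitiveY p) (γ t) = p (γ t) := fun t =>
    (hasDerivAt_partialY ((hR t).differentiableAt one_ne_zero)).unique
      (hasDerivAt_primitiveY hp (hη t))
  have hFX := hγ.continuous_partialX hF
  have hFY := hγ.continuous_partialY hF
  have hRX := hγ.continuous_partialX hR
  have hpγ : Continuous fun t => p (γ t) := hp.comp_continuous hγ.continuous hη
  have hqγ : Continuous fun t => q (γ t) := hq.comp_continuous hγ.continuous hη
  have hbracket := hγ.integral_bracket_eq_zero hF hR
  simp only [hRY] at hbracket
  calc
    _ = (∫ t in (0 : ℝ)..T, (partialY F (γ t) * q (γ t) + partialX F (γ t) * p (γ t))) +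
        ∫ t in (0 : ℝ)..T,
          (partialX (primitiveY p) (γ t) * partialY F (γ t) - p (γ t) * partialX F (γ t)) := by
      rw [hbracket, add_zero]
    _ = ∫ t in (0 : ℝ)..T, ((partialY F (γ t) * q (γ t) + partialX F (γ t) * p (γ t)) +
          (partialX (primitiveY p) (γ t) * partialY F (γ t) - p (γ t) * partialX F (γ t))) :=
      (intervalIntegral.integral_add (((hFY.mul hqγ).add (hFX.mul hpγ)).intervalIntegrable 0 T)
        (((hRX.mul hFY).sub (hpγ.mul hFX)).intervalIntegrable 0 T)).symm
    _ = ∫ t in (0 : ℝ)..T, reducedForm p q (γ t) * partialY F (γ t) := by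
      refine intervalIntegral.integral_congr fun t _ => ?_
      simp only [reducedForm]
      ring

variable {E : Type*} [NormedAddCommGroup E] [NormedSpace ℝ E] {n : WithTop ℕ∞}
  {P Q : ℝ × ℝ → E → ℝ} {δ : E}

theorem contDiffAt_primitiveY (hP : ContDiffAt ℝ n (fun w : (ℝ × ℝ) × E => P w.1 w.2) (0, δ)) :
    ContDiffAt ℝ n (fun w : (ℝ × ℝ) × E => primitiveY (P · w.2) w.1) (0, δ) := by
  simp only [primitiveY_eq_integral_unit]
  refine contDiffAt_integral_arc (σ := id) (x₀ := ((0, δ) : (ℝ × ℝ) × E)) zero_le_one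
    continuous_id
    (f := fun w : ((ℝ × ℝ) × E) × ℝ => w.1.1.2 * P (w.1.1.1, w.2 * w.1.1.2) w.1.2) fun s _ => ?_
  refine ContDiffAt.mul (by fun_prop) ?_
  refine ContDiffAt.comp (g := fun w : (ℝ × ℝ) × E => P w.1 w.2)
    (f := fun w : ((ℝ × ℝ) × E) × ℝ => ((w.1.1.1, w.2 * w.1.1.2), w.1.2)) _ ?_ (by fun_prop)
  simpa [Prod.mk_zero_zero] using hP

theorem contDiffAt_reducedForm (hn : ∞ ≤ n)
    (hP : ContDiffAt ℝ n (fun w : (ℝ × ℝ) × E => P w.1 w.2) (0, δ))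
    (hQ : ContDiffAt ℝ n (fun w : (ℝ × ℝ) × E => Q w.1 w.2) (0, δ)) :
    ContDiffAt ℝ n (fun w : (ℝ × ℝ) × E => reducedForm (P · w.2) (Q · w.2) w.1) (0, δ) := by
  have hfderiv := ContDiffAt.fderiv (n := n) (m := n) (x₀ := ((0, δ) : (ℝ × ℝ) × E))
    (f := fun (w : (ℝ × ℝ) × E) z => primitiveY (P · w.2) z) (g := fun w => w.1)
    (ContDiffAt.comp (g := fun w : (ℝ × ℝ) × E => primitiveY (P · w.2) w.1)
      (f := fun w : ((ℝ × ℝ) × E) × (ℝ × ℝ) => (w.2, w.1.2)) _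
      (contDiffAt_primitiveY hP) (by fun_prop))
    contDiffAt_fst (add_one_le_of_infty_le hn)
  exact hQ.add (hfderiv.clm_apply contDiffAt_const)

end LineIntegral

section ScaledMelnikov

variable {E : Type*} [NormedAddCommGroup E] [NormedSpace ℝ E] {n : WithTop ℕ∞}

theorem hadamardQuotient_neg_of_odd {f : E × ℝ → ℝ} (hf : ∀ x y, f (x, -y) = -f (x, y)) (x : E)
    (y : ℝ) : hadamardQuotient f (x, -y) = hadamardQuotient f (x, y) := by
  let e : (E × ℝ) ≃L[ℝ] E × ℝ :=
    (ContinuousLinearEquiv.refl ℝ E).prodCongr (ContinuousLinearEquiv.neg ℝ)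
  have hfe : f ∘ e = -f := funext fun z => hf z.1 z.2
  have heven : ∀ a, fderiv ℝ f (x, -a) (0, 1) = fderiv ℝ f (x, a) (0, 1) := fun a => by
    have hcomp := DFunLike.congr_fun (e.comp_right_fderiv (f := f) (x := (x, a))) (0, -1)
    rw [hfe, fderiv_neg, ContinuousLinearMap.comp_apply] at hcomp
    have hneg : ((0 : E), (-1 : ℝ)) = -(0, 1) := by simp
    have he : e (x, a) = (x, -a) := rfl
    have he' : (e : (E × ℝ) →L[ℝ] E × ℝ) (0, -1) = (0, 1) := Prod.ext rfl (neg_neg 1)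
    rwa [he, he', neg_apply, hneg, map_neg, neg_neg, eq_comm] at hcomp
  simp only [hadamardQuotient, mul_neg, heven]

/-- The difference of `f` and its reflection in the last variable, that is, twice the odd part. -/
def oddDifference (f : E × ℝ → ℝ) (z : E × ℝ) : ℝ := f z - f (z.1, -z.2)

theorem contDiffAt_oddDifference {f : E × ℝ → ℝ} {x : E} (hf : ContDiffAt ℝ n f (x, 0)) :
    ContDiffAt ℝ n (oddDifference f) (x, 0) := by
  refine hf.sub (ContDiffAt.comp (g := f) (f := fun z : E × ℝ => (z.1, -z.2)) _ ?_ (by fun_prop))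
  simpa using hf

/-- The integral `ρ^{-(p+1)} ∮ f(x, δ, y) dx` over the closed curve `x^{2p} + y² = ρ^{2p}`. After
the substitution `x = ρ s`, both arcs are graphs `y = ± ρ^p √(1 - s^{2p})`, and the odd difference
of `f` is divisible by `y`, so that the division by `ρ^{p+1}` can be carried out also at `ρ = 0`. -/
def scaledMelnikov (p : ℕ) (f : (ℝ × E) × ℝ → ℝ) (w : ℝ × E) : ℝ :=
  ∫ s in (-1 : ℝ)..1, √(1 - s ^ (2 * p)) *
    hadamardQuotient (oddDifference f) ((w.1 * s, w.2), w.1 ^ p * √(1 - s ^ (2 * p)))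

theorem scaledMelnikov_neg (p : ℕ) (f : (ℝ × E) × ℝ → ℝ) (ρ : ℝ) (δ : E) :
    scaledMelnikov p f (-ρ, δ) = scaledMelnikov p f (ρ, δ) := by
  have hodd : ∀ x y, oddDifference f (x, -y) = -oddDifference f (x, y) := fun x y => by
    simp only [oddDifference, neg_neg, neg_sub]
  have hreflect := intervalIntegral.integral_comp_neg (a := -1) (b := 1)
    (fun s : ℝ => √(1 - s ^ (2 * p)) *
      hadamardQuotient (oddDifference f) ((-ρ * s, δ), (-ρ) ^ p * √(1 - s ^ (2 * p))))
  rw [neg_neg] at hreflect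
  rw [scaledMelnikov, ← hreflect]
  refine intervalIntegral.integral_congr fun s _ => ?_
  simp only [(even_two_mul p).neg_pow, neg_mul_neg]
  rcases p.even_or_odd with hp | hp
  · rw [hp.neg_pow]
  · rw [hp.neg_pow, neg_mul, hadamardQuotient_neg_of_odd hodd]

theorem contDiffAt_scaledMelnikov (hn : ∞ ≤ n) {p : ℕ} (hp : 1 ≤ p) {f : (ℝ × E) × ℝ → ℝ} {δ : E}
    (hf : ContDiffAt ℝ n f ((0, δ), 0)) : ContDiffAt ℝ n (scaledMelnikov p f) (0, δ) := by
  refine contDiffAt_integral_arc (σ := fun s : ℝ => (s, √(1 - s ^ (2 * p))))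
    (x₀ := ((0, δ) : ℝ × E)) (by norm_num) (by fun_prop)
    (f := fun w : (ℝ × E) × (ℝ × ℝ) => w.2.2 *
      hadamardQuotient (oddDifference f) ((w.1.1 * w.2.1, w.1.2), w.1.1 ^ p * w.2.2)) fun s _ => ?_
  refine ContDiffAt.mul (by fun_prop) (ContDiffAt.comp (g := hadamardQuotient (oddDifference f))
    (f := fun w : (ℝ × E) × (ℝ × ℝ) => ((w.1.1 * w.2.1, w.1.2), w.1.1 ^ p * w.2.2)) _ ?_
    (by fun_prop))
  have hquot := contDiffAt_hadamardQuotient_zero (add_one_le_of_infty_le hn)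
    (contDiffAt_oddDifference hf)
  simpa [show p ≠ 0 by omega] using hquot

theorem sqrt_pow_sub_mul_pow {ρ : ℝ} (hρ : 0 ≤ ρ) (p : ℕ) (s : ℝ) :
    √(ρ ^ (2 * p) - (ρ * s) ^ (2 * p)) = ρ ^ p * √(1 - s ^ (2 * p)) := by
  rw [mul_pow, ← mul_one_sub, mul_comm 2 p, pow_mul ρ, Real.sqrt_mul (by positivity),
    Real.sqrt_sq (by positivity)]

theorem mul_pow_add_sq_eq {ρ s : ℝ} (p : ℕ) (hs : s ∈ Icc (-1) 1) :
    (ρ * s) ^ (2 * p) + (ρ ^ p * √(1 - s ^ (2 * p))) ^ 2 = ρ ^ (2 * p) := by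
  have hle : s ^ (2 * p) ≤ 1 := by
    rw [← (even_two_mul p).pow_abs]
    exact pow_le_one₀ (abs_nonneg s) (abs_le.2 hs)
  rw [mul_pow, mul_pow, Real.sq_sqrt (sub_nonneg.2 hle)]
  ring

theorem IsClockwiseLoop.integral_eq_scaledMelnikov {p : ℕ} {ρ : ℝ} {x y : ℝ → ℝ} {T : ℝ}
    (hl : IsClockwiseLoop p ρ x y T) (hp : 1 ≤ p) (hρ : 0 < ρ) {f : (ℝ × E) × ℝ → ℝ} {δ : E}
    (hf : ContinuousOn (fun z : ℝ × ℝ => f ((z.1, δ), z.2))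
      {z | z.1 ^ (2 * p) + z.2 ^ 2 = ρ ^ (2 * p)})
    (hquot : ∀ z ∈ {z : ℝ × ℝ | z.1 ^ (2 * p) + z.2 ^ 2 = ρ ^ (2 * p)},
      oddDifference f ((z.1, δ), z.2) =
        z.2 * hadamardQuotient (oddDifference f) ((z.1, δ), z.2)) :
    ∫ t in (0 : ℝ)..T, f ((x t, δ), y t) * deriv x t = ρ ^ (p + 1) * scaledMelnikov p f (ρ, δ) := by
  have hscale := intervalIntegral.smul_integral_comp_mul_left (a := -1) (b := 1)
    (fun s => oddDifference f ((s, δ), √(ρ ^ (2 * p) - s ^ (2 * p)))) ρ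
  rw [mul_neg_one, mul_one, smul_eq_mul] at hscale
  refine (hl.integral_eq (f := fun z => f ((z.1, δ), z.2)) hp hρ hf).trans (hscale.symm.trans ?_)
  rw [scaledMelnikov, pow_succ', mul_assoc, ← intervalIntegral.integral_const_mul (ρ ^ p)]
  congr 1
  refine intervalIntegral.integral_congr fun s hs => ?_
  rw [uIcc_of_le (by norm_num)] at hs
  simp only [sqrt_pow_sub_mul_pow hρ.le]
  rw [hquot (ρ * s, ρ ^ p * √(1 - s ^ (2 * p))) (mul_pow_add_sq_eq p hs), mul_assoc]

/-- The coefficient of the one-form `K du`, with parameter `δ`, in the coordinates `(x, y)` given by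
`u = U x`, `v = V (x, y)`. The variables are ordered as `((x, δ), y)`, so that `hadamardQuotient`
divides by `y`. -/
def pulledBackForm (U : ℝ → ℝ) (V : ℝ × ℝ → ℝ) (K : ℝ × ℝ → E → ℝ) (w : (ℝ × E) × ℝ) : ℝ :=
  K (U w.1.1, V (w.1.1, w.2)) w.1.2 * deriv U w.1.1

theorem contDiffAt_pulledBackForm (hn : ∞ ≤ n) {U : ℝ → ℝ} {V : ℝ × ℝ → ℝ} {K : ℝ × ℝ → E → ℝ}
    (hU : ContDiffAt ℝ n U 0) (hV : ContDiffAt ℝ n V 0) (hU0 : U 0 = 0) (hV0 : V 0 = 0) {δ : E}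
    (hK : ContDiffAt ℝ n (fun w : (ℝ × ℝ) × E => K w.1 w.2) (0, δ)) :
    ContDiffAt ℝ n (pulledBackForm U V K) ((0, δ), 0) := by
  have hU' : ContDiffAt ℝ n (deriv U) 0 :=
    (hU.fderiv_right (add_one_le_of_infty_le hn)).clm_apply contDiffAt_const
  have hUV : ContDiffAt ℝ n (fun w : (ℝ × E) × ℝ => ((U w.1.1, V (w.1.1, w.2)), w.1.2))
      ((0, δ), 0) :=
    ((ContDiffAt.comp (g := U) (f := fun w : (ℝ × E) × ℝ => w.1.1) _ hU (by fun_prop)).prodMk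
      (ContDiffAt.comp (g := V) (f := fun w : (ℝ × E) × ℝ => (w.1.1, w.2)) _ hV
        (by fun_prop))).prodMk (by fun_prop)
  refine ContDiffAt.mul (ContDiffAt.comp (g := fun w : (ℝ × ℝ) × E => K w.1 w.2) _ ?_ hUV)
    (ContDiffAt.comp (g := deriv U) (f := fun w : (ℝ × E) × ℝ => w.1.1) _ hU' (by fun_prop))
  simpa [Prod.mk_zero_zero, hU0, hV0] using hK

theorem IsPeriodicOrbit.integral_eq_integral_pulledBackForm {E : Type*}
    {F : ℝ × ℝ → ℝ} {h : ℝ} {γ : ℝ → ℝ × ℝ} {T : ℝ} (hγ : IsPeriodicOrbit F h γ T) {p : ℕ}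
    {X U : ℝ → ℝ} {Y V : ℝ × ℝ → ℝ} (hN : ∀ t, NormalCoordinatesAt F p X Y U V (γ t))
    (K : ℝ × ℝ → E → ℝ) (δ : E) :
    ∫ t in (0 : ℝ)..T, K (γ t) δ * partialY F (γ t) =
      ∫ t in (0 : ℝ)..T, pulledBackForm U V K ((X (γ t).1, δ), Y (γ t)) *
        deriv (fun t => X (γ t).1) t := by
  refine intervalIntegral.integral_congr fun t _ => ?_
  have hX : HasDerivAt (fun t => X (γ t).1) (deriv (fun t => X (γ t).1) t) t :=
    (DifferentiableAt.comp t ((hN t).contDiffAt_fst.differentiableAt one_ne_zero)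
      (hγ.hasDerivAt_fst t).differentiableAt).hasDerivAt
  have hUX : HasDerivAt (fun t => (γ t).1) _ t :=
    ((hN t).differentiableAt_inv_fst.hasDerivAt.comp t hX).congr_of_eventuallyEq
      (.of_forall fun t => (hN t).inv_fst.symm)
  simp only [pulledBackForm, (hN t).inv_fst, (hN t).inv_snd]
  rw [(hγ.hasDerivAt_fst t).unique hUX, mul_assoc]

end ScaledMelnikov

section MelnikovNearCenter

variable {E : Type*} [NormedAddCommGroup E] [NormedSpace ℝ E] {n : WithTop ℕ∞}

theorem HasCenterOrder.apply_zero {F : ℝ × ℝ → ℝ} {p : ℕ} (hord : HasCenterOrder F p)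
    (hp : 1 ≤ p) : F 0 = 0 := by
  obtain ⟨φ, -, hφO, -, c, -, hcO⟩ := hord
  have hφ0 : φ 0 = 0 := by simpa using hφO.eq_zero_imp.self_of_nhds
  simpa [hφ0, show p ≠ 0 by omega, Prod.mk_zero_zero] using hcO.eq_zero_imp.self_of_nhds

theorem tendsto_pow_nhdsGT_zero {m : ℕ} (hm : m ≠ 0) :
    Tendsto (fun ρ : ℝ => ρ ^ m) (𝓝[>] 0) (𝓝[>] 0) := by
  refine tendsto_nhdsWithin_iff.2 ⟨?_, ?_⟩
  · simpa [hm] using ((continuous_pow m).tendsto (0 : ℝ)).mono_left nhdsWithin_le_nhds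
  · filter_upwards [self_mem_nhdsWithin] with ρ hρ using pow_pos (mem_Ioi.1 hρ) m

theorem eventually_level_subset {p : ℕ} (hp : 1 ≤ p) {s : Set (ℝ × ℝ)} (hs : s ∈ 𝓝 0) :
    ∀ᶠ ρ in 𝓝[>] (0 : ℝ), {z : ℝ × ℝ | z.1 ^ (2 * p) + z.2 ^ 2 = ρ ^ (2 * p)} ⊆ s := by
  obtain ⟨η, hη, hball⟩ := Metric.mem_nhds_iff.1 hs
  filter_upwards [Ioo_mem_nhdsGT (lt_min one_pos hη)] with ρ hρ z hz
  have hz1 : |z.1| ≤ ρ := by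
    have hpow : |z.1| ^ (2 * p) ≤ ρ ^ (2 * p) := by
      rw [(even_two_mul p).pow_abs, ← hz]
      exact le_add_of_nonneg_right (sq_nonneg _)
    exact (pow_le_pow_iff_left₀ (abs_nonneg _) hρ.1.le (by omega)).1 hpow
  have hz2 : |z.2| ≤ ρ := by
    have hsq : z.2 ^ 2 ≤ ρ ^ 2 := calc
      z.2 ^ 2 ≤ ρ ^ (2 * p) := hz ▸ le_add_of_nonneg_left ((even_two_mul p).pow_nonneg _)
      _ ≤ ρ ^ 2 := pow_le_pow_of_le_one hρ.1.le (hρ.2.le.trans (min_le_left _ _)) (by omega)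
    exact abs_le_of_sq_le_sq hsq hρ.1.le
  refine hball (mem_ball_zero_iff.2 ?_)
  exact (max_le hz1 hz2).trans_lt (hρ.2.trans_le (min_le_right _ _))

theorem eventually_forall_contDiffAt_slice (hn : 1 ≤ n) {G : (ℝ × ℝ) × E → ℝ} {Δ : Set E}
    (hΔ : IsCompact Δ) (hG : ∀ δ ∈ Δ, ContDiffAt ℝ n G (0, δ)) :
    ∀ᶠ z in 𝓝 0, ∀ δ ∈ Δ, ContDiffAt ℝ 1 (fun z => G (z, δ)) z := by
  refine hΔ.eventually_forall_of_forall_eventually fun δ hδ => ?_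
  filter_upwards [((hG δ hδ).of_le hn).eventually (by simp)] with w hw
  exact ContDiffAt.comp (g := G) w.1 hw (contDiffAt_id.prodMk contDiffAt_const)

theorem CenterFamily.eventually_isPeriodicOrbit {F : ℝ × ℝ → ℝ} (L : CenterFamily F (0, 0))
    (hF0 : F 0 = 0) {p : ℕ} (hp : 1 ≤ p) {s : Set (ℝ × ℝ)} (hs : s ∈ 𝓝 0) :
    ∀ᶠ ρ in 𝓝[>] (0 : ℝ),
      IsPeriodicOrbit F (ρ ^ (2 * p)) (L.orbit (ρ ^ (2 * p))) (L.period (ρ ^ (2 * p))) ∧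
      ∀ t, L.orbit (ρ ^ (2 * p)) t ∈ s := by
  rw [← Prod.mk_zero_zero] at hF0 hs
  have hpow := tendsto_pow_nhdsGT_zero (m := 2 * p) (by omega)
  have hshrinks := L.shrinks s hs
  rw [hF0] at hshrinks
  filter_upwards [hpow.eventually hshrinks, hpow.eventually (Ioo_mem_nhdsGT L.β_pos)]
    with ρ hρs hρβ
  exact ⟨L.isPeriodicOrbit _ (by rwa [hF0, zero_add]), range_subset_iff.1 hρs⟩

theorem eventually_continuousOn_level {p : ℕ} (hn : 1 ≤ n) (hp : 1 ≤ p) {f : (ℝ × E) × ℝ → ℝ}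
    {Δ : Set E} (hΔ : IsCompact Δ) (hf : ∀ δ ∈ Δ, ContDiffAt ℝ n f ((0, δ), 0)) :
    ∀ᶠ ρ in 𝓝[>] (0 : ℝ), ∀ δ ∈ Δ, ContinuousOn (fun z : ℝ × ℝ => f ((z.1, δ), z.2))
      {z | z.1 ^ (2 * p) + z.2 ^ 2 = ρ ^ (2 * p)} := by
  have hG : ∀ᶠ z in 𝓝 (0 : ℝ × ℝ), ∀ δ ∈ Δ,
      ContDiffAt ℝ 1 (fun z : ℝ × ℝ => f ((z.1, δ), z.2)) z :=
    eventually_forall_contDiffAt_slice (G := fun w => f ((w.1.1, w.2), w.1.2)) hn hΔ fun δ hδ =>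
      ContDiffAt.comp (g := f) (f := fun w : (ℝ × ℝ) × E => ((w.1.1, w.2), w.1.2)) _ (hf δ hδ)
        (by fun_prop)
  filter_upwards [eventually_level_subset hp hG] with ρ hρ δ hδ z hz
  exact (hρ hz δ hδ).continuousAt.continuousWithinAt

theorem eventually_oddDifference_eq_mul {p : ℕ} (hn : 1 ≤ n) (hp : 1 ≤ p) {f : (ℝ × E) × ℝ → ℝ}
    {Δ : Set E} (hΔ : IsCompact Δ) (hf : ∀ δ ∈ Δ, ContDiffAt ℝ n f ((0, δ), 0)) :
    ∀ᶠ ρ in 𝓝[>] (0 : ℝ), ∀ δ ∈ Δ, ∀ z ∈ {z : ℝ × ℝ | z.1 ^ (2 * p) + z.2 ^ 2 = ρ ^ (2 * p)},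
      oddDifference f ((z.1, δ), z.2) =
        z.2 * hadamardQuotient (oddDifference f) ((z.1, δ), z.2) := by
  have hquot : ∀ᶠ z in 𝓝 (0 : ℝ × ℝ), ∀ δ ∈ Δ, oddDifference f ((z.1, δ), z.2) =
      z.2 * hadamardQuotient (oddDifference f) ((z.1, δ), z.2) := by
    refine hΔ.eventually_forall_of_forall_eventually (P := fun (z : ℝ × ℝ) δ =>
      oddDifference f ((z.1, δ), z.2) =
        z.2 * hadamardQuotient (oddDifference f) ((z.1, δ), z.2)) fun δ hδ => ?_
    have hreorder : Tendsto (fun w : (ℝ × ℝ) × E => ((w.1.1, w.2), w.1.2)) (𝓝 (0, δ))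
        (𝓝 ((0, δ), 0)) :=
      Continuous.tendsto (by fun_prop) ((0, δ) : (ℝ × ℝ) × E)
    exact hreorder.eventually (eventually_eq_mul_hadamardQuotient
      ((contDiffAt_oddDifference (hf δ hδ)).of_le hn) (.of_forall fun x => by simp [oddDifference]))
  filter_upwards [eventually_level_subset hp hquot] with ρ hρ δ hδ z hz using hρ hz δ hδ

theorem CenterFamily.eventually_melnikov_eq_integral_reducedForm (hn : ∞ ≤ n) {F : ℝ × ℝ → ℝ}
    (hF : ContDiffAt ℝ n F 0) (hF0 : F 0 = 0) {p : ℕ} (hp : 1 ≤ p) {P Q : ℝ × ℝ → E → ℝ}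
    {Δ : Set E} (hΔ : IsCompact Δ)
    (hP : ∀ δ ∈ Δ, ContDiffAt ℝ n (fun w : (ℝ × ℝ) × E => P w.1 w.2) (0, δ))
    (hQ : ∀ δ ∈ Δ, ContDiffAt ℝ n (fun w : (ℝ × ℝ) × E => Q w.1 w.2) (0, δ))
    (L : CenterFamily F (0, 0)) :
    ∀ᶠ ρ in 𝓝[>] (0 : ℝ), ∀ δ ∈ Δ, L.melnikov P Q (ρ ^ (2 * p)) δ =
      ∫ t in (0 : ℝ)..L.period (ρ ^ (2 * p)),
        reducedForm (P · δ) (Q · δ) (L.orbit (ρ ^ (2 * p)) t) *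
          partialY F (L.orbit (ρ ^ (2 * p)) t) := by
  have hn1 := one_le_of_infty_le hn
  obtain ⟨η, hη, hball⟩ := Metric.eventually_nhds_iff_ball.1
    (((hF.of_le hn1).eventually (by simp)).and
      ((eventually_forall_contDiffAt_slice hn1 hΔ hP).and
        ((eventually_forall_contDiffAt_slice hn1 hΔ hQ).and
          (eventually_forall_contDiffAt_slice hn1 hΔ fun δ hδ =>
            contDiffAt_primitiveY (hP δ hδ)))))
  filter_upwards [L.eventually_isPeriodicOrbit hF0 hp (Metric.ball_mem_nhds _ hη)]
    with ρ ⟨hγ, hγη⟩ δ hδ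
  exact hγ.integral_eq_integral_reducedForm hγη (fun t => (hball _ (hγη t)).1)
    (fun z hz => ((hball z hz).2.1 δ hδ).continuousAt.continuousWithinAt)
    (fun z hz => ((hball z hz).2.2.1 δ hδ).continuousAt.continuousWithinAt)
    (fun t => (hball _ (hγη t)).2.2.2 δ hδ)

theorem exists_melnikov_eq_pow_mul (hn : ∞ ≤ n) {F : ℝ × ℝ → ℝ} (hF : ContDiffAt ℝ n F 0)
    (hF' : 0 < partialY (partialY F) 0) {p : ℕ} (hp : 1 ≤ p) (hord : HasCenterOrder F p)
    {P Q : ℝ × ℝ → E → ℝ} {Δ : Set E} (hΔ : IsCompact Δ)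
    (hP : ∀ δ ∈ Δ, ContDiffAt ℝ n (fun w : (ℝ × ℝ) × E => P w.1 w.2) (0, δ))
    (hQ : ∀ δ ∈ Δ, ContDiffAt ℝ n (fun w : (ℝ × ℝ) × E => Q w.1 w.2) (0, δ)) :
    ∃ S : ℝ × E → ℝ, (∀ δ ∈ Δ, ContDiffAt ℝ n S (0, δ)) ∧ (∀ ρ δ, S (-ρ, δ) = S (ρ, δ)) ∧
      ∀ L : CenterFamily F (0, 0), ∀ᶠ ρ in 𝓝[>] (0 : ℝ), ∀ δ ∈ Δ,
        L.melnikov P Q (ρ ^ (2 * p)) δ = ρ ^ (p + 1) * S (ρ, δ) := by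
  have hn1 := one_le_of_infty_le hn
  have hF0 := hord.apply_zero hp
  obtain ⟨X, Y, U, V, hU, hV, hU0, hV0, hN⟩ := exists_normalCoordinates hn hF hF' hp hord
  let K : ℝ × ℝ → E → ℝ := fun z δ => reducedForm (P · δ) (Q · δ) z
  have hf : ∀ δ ∈ Δ, ContDiffAt ℝ n (pulledBackForm U V K) ((0, δ), 0) := fun δ hδ =>
    contDiffAt_pulledBackForm hn hU hV hU0 hV0 (contDiffAt_reducedForm hn (hP δ hδ) (hQ δ hδ))
  refine ⟨scaledMelnikov p (pulledBackForm U V K),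
    fun δ hδ => contDiffAt_scaledMelnikov hn hp (hf δ hδ), scaledMelnikov_neg p _, fun L => ?_⟩
  filter_upwards [L.eventually_melnikov_eq_integral_reducedForm hn hF hF0 hp hΔ hP hQ,
    L.eventually_isPeriodicOrbit hF0 hp hN, eventually_continuousOn_level hn1 hp hΔ hf,
    eventually_oddDifference_eq_mul hn1 hp hΔ hf, self_mem_nhdsWithin]
    with ρ hM ⟨hγ, hγN⟩ hcont hquot hρ δ hδ
  rw [hM δ hδ, hγ.integral_eq_integral_pulledBackForm hγN K δ]
  exact (hγ.isClockwiseLoop hγN).integral_eq_scaledMelnikov hp hρ (hcont δ hδ) (hquot δ hδ)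

end MelnikovNearCenter

section EvenTaylor

variable {E : Type*} [NormedAddCommGroup E] [NormedSpace ℝ E] {n : WithTop ℕ∞} {Δ : Set E}
  {S : ℝ × E → ℝ}

theorem contDiffAt_iteratedDeriv_fst (hn : ∞ ≤ n) (k : ℕ) {w : ℝ × E} (hS : ContDiffAt ℝ n S w) :
    ContDiffAt ℝ n (fun w : ℝ × E => iteratedDeriv k (fun ρ => S (ρ, w.2)) w.1) w := by
  induction k with
  | zero => simpa only [iteratedDeriv_zero] using hS
  | succ k ih =>
    simp only [iteratedDeriv_succ]
    exact (ContDiffAt.fderiv (f := fun (w : ℝ × E) x => iteratedDeriv k (fun ρ => S (ρ, w.2)) x)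
      (ContDiffAt.comp (w, w.1) ih (f := fun z : (ℝ × E) × ℝ => (z.2, z.1.2)) (by fun_prop))
      contDiffAt_fst (add_one_le_of_infty_le hn)).clm_apply contDiffAt_const

theorem iteratedDeriv_odd_eq_zero_of_even {f : ℝ → ℝ} (hf : ∀ x, f (-x) = f x) (j : ℕ) :
    iteratedDeriv (2 * j + 1) f 0 = 0 := by
  have hneg := iteratedDeriv_comp_neg (2 * j + 1) f 0
  simp only [hf, neg_zero, (odd_two_mul_add_one j).neg_one_pow, neg_smul, one_smul] at hneg
  exact self_eq_neg.1 hneg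

theorem sum_range_two_mul_of_odd_eq_zero {R : Type*} [AddCommMonoid R] {a : ℕ → R}
    (ha : ∀ j, a (2 * j + 1) = 0) (N : ℕ) :
    ∑ k ∈ Finset.range (2 * N), a k = ∑ j ∈ Finset.range N, a (2 * j) := by
  induction N with
  | zero => simp
  | succ N ih =>
    rw [Nat.mul_succ, Finset.sum_range_succ, Finset.sum_range_succ, ih, ha, add_zero,
      Finset.sum_range_succ]

theorem abs_sub_taylorSum_le {f : ℝ → ℝ} {m : ℕ} {ρ C : ℝ} (hρ : 0 < ρ)
    (hf : ∀ y ∈ Icc 0 ρ, ContDiffAt ℝ m f y) (hC : ∀ y ∈ Icc 0 ρ, |iteratedDeriv m f y| ≤ C) :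
    |f ρ - ∑ k ∈ Finset.range m, (k.factorial : ℝ)⁻¹ * iteratedDeriv k f 0 * ρ ^ k| ≤
      C * ρ ^ m := by
  have h0 : (0 : ℝ) ∈ Icc 0 ρ := left_mem_Icc.2 hρ.le
  have hρ' : ρ ∈ Icc 0 ρ := right_mem_Icc.2 hρ.le
  rcases m with - | m
  · simpa using hC ρ hρ'
  have hwithin : ∀ y ∈ Icc 0 ρ, ∀ k ≤ m + 1,
      iteratedDerivWithin k f (Icc 0 ρ) y = iteratedDeriv k f y := fun y hy k hk =>
    iteratedDerivWithin_eq_iteratedDeriv (uniqueDiffOn_Icc hρ)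
      ((hf y hy).of_le (by exact_mod_cast hk)) hy
  have hsum : taylorWithinEval f m (Icc 0 ρ) 0 ρ =
      ∑ k ∈ Finset.range (m + 1), (k.factorial : ℝ)⁻¹ * iteratedDeriv k f 0 * ρ ^ k := by
    rw [taylor_within_apply]
    refine Finset.sum_congr rfl fun k hk => ?_
    rw [hwithin 0 h0 k (Finset.mem_range.1 hk).le, sub_zero, smul_eq_mul, mul_right_comm]
  have htaylor := taylor_mean_remainder_bound (C := C) (n := m) hρ.le
    (fun y hy => by simpa only [Nat.cast_add_one] using (hf y hy).contDiffWithinAt) hρ'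
    (fun y hy => by rw [hwithin y hy _ le_rfl]; exact hC y hy)
  rw [hsum, sub_zero, Real.norm_eq_abs] at htaylor
  have hC0 : 0 ≤ C := (abs_nonneg _).trans (hC ρ hρ')
  refine htaylor.trans (div_le_self (by positivity) ?_)
  exact_mod_cast Nat.one_le_iff_ne_zero.2 m.factorial_ne_zero

/-- The coefficient of `ρ^{2j}` in the Taylor expansion of `ρ ↦ S (ρ, δ)` at `0`. -/
def evenCoeff {E : Type*} (S : ℝ × E → ℝ) (j : ℕ) (δ : E) : ℝ :=
  ((2 * j).factorial : ℝ)⁻¹ * iteratedDeriv (2 * j) (fun ρ => S (ρ, δ)) 0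

theorem exists_bound_sub_sum_evenCoeff (hΔ : IsCompact Δ) (hS : ∀ δ ∈ Δ, ContDiffAt ℝ ∞ S (0, δ))
    (heven : ∀ ρ δ, S (-ρ, δ) = S (ρ, δ)) (N : ℕ) :
    ∃ C, ∀ᶠ ρ in 𝓝[>] (0 : ℝ), ∀ δ ∈ Δ,
      |S (ρ, δ) - ∑ j ∈ Finset.range N, evenCoeff S j δ * ρ ^ (2 * j)| ≤ C * ρ ^ (2 * N) := by
  let D : ℝ × E → ℝ := fun w => iteratedDeriv (2 * N) (fun ρ => S (ρ, w.2)) w.1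
  have hD : ∀ δ ∈ Δ, ContinuousAt D (0, δ) := fun δ hδ =>
    (contDiffAt_iteratedDeriv_fst le_rfl (2 * N) (hS δ hδ)).continuousAt
  obtain ⟨C, hC⟩ := hΔ.exists_bound_of_continuousOn (f := fun δ => D (0, δ)) fun δ hδ =>
    ((hD δ hδ).comp (f := fun δ : E => ((0 : ℝ), δ)) (by fun_prop)).continuousWithinAt
  have hnear : ∀ᶠ ρ in 𝓝 (0 : ℝ), ∀ δ ∈ Δ, |D (ρ, δ)| ≤ C + 1 ∧
      ContDiffAt ℝ (2 * N : ℕ) S (ρ, δ) := by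
    refine hΔ.eventually_forall_of_forall_eventually fun δ hδ => ?_
    filter_upwards [(hD δ hδ).norm.eventually (gt_mem_nhds ((hC δ hδ).trans_lt (lt_add_one C))),
      (contDiffAt_infty.1 (hS δ hδ) (2 * N)).eventually
        (WithTop.coe_injective.ne (ENat.natCast_ne_top _))] with w hDw hSw using ⟨hDw.le, hSw⟩
  obtain ⟨η, hη, hball⟩ := Metric.eventually_nhds_iff_ball.1 hnear
  refine ⟨C + 1, ?_⟩
  filter_upwards [Ioo_mem_nhdsGT hη] with ρ hρ δ hδ
  have hmem : ∀ y ∈ Icc 0 ρ, y ∈ Metric.ball (0 : ℝ) η := fun y hy => by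
    simpa [abs_of_nonneg hy.1] using hy.2.trans_lt hρ.2
  have htaylor := abs_sub_taylorSum_le (f := fun ρ => S (ρ, δ)) hρ.1
    (fun y hy => ContDiffAt.comp (g := S) y (hball y (hmem y hy) δ hδ).2
      (contDiffAt_id.prodMk contDiffAt_const)) (fun y hy => (hball y (hmem y hy) δ hδ).1)
  rwa [sum_range_two_mul_of_odd_eq_zero fun j => by
    rw [iteratedDeriv_odd_eq_zero_of_even fun x => heven x δ, mul_zero, zero_mul]] at htaylor

theorem eventually_hasSum_of_analyticAt {δ₀ : E} (hS : AnalyticAt ℝ S (0, δ₀)) :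
    ∀ᶠ w in 𝓝 ((0, δ₀) : ℝ × E),
      HasSum (fun k => (k.factorial : ℝ)⁻¹ * iteratedDeriv k (fun ρ => S (ρ, w.2)) 0 * w.1 ^ k)
        (S w) := by
  obtain ⟨q, R, hq⟩ := hS
  obtain ⟨r, hr, hrR⟩ := ENNReal.lt_iff_exists_nnreal_btwn.1 hq.r_pos
  have hr2 : 0 < r / 2 := half_pos (by exact_mod_cast hr)
  filter_upwards [Metric.ball_mem_nhds ((0, δ₀) : ℝ × E) (NNReal.coe_pos.2 hr2)] with ⟨ρ, δ⟩ hw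
  rw [mem_ball_iff_norm, Prod.norm_def, max_lt_iff] at hw
  have hsub : ((r / 2 : NNReal) : ENNReal) + (r / 2 : NNReal) < R := by
    rwa [← ENNReal.coe_add, add_halves]
  have hball : ρ ∈ Metric.eball (0 : ℝ) (r / 2 : NNReal) := by
    rw [mem_eball_zero_iff, enorm_eq_nnnorm, ENNReal.coe_lt_coe, ← NNReal.coe_lt_coe]
    simpa using hw.1
  have hsum := (hasFPowerSeriesOnBall_fiberSeries hq hr2 hsub hw.2.le).hasSum_iteratedFDeriv hball
  rw [zero_add] at hsum
  refine hsum.congr_fun fun k => ?_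
  simp only [iteratedFDeriv_apply_eq_iteratedDeriv_mul_prod, Finset.prod_const, Finset.card_univ,
    Fintype.card_fin, smul_eq_mul]
  rw [mul_assoc, mul_comm (iteratedDeriv _ _ _)]

theorem hasSum_evenCoeff {E : Type*} {S : ℝ × E → ℝ} (heven : ∀ ρ δ, S (-ρ, δ) = S (ρ, δ)) {ρ : ℝ}
    {δ : E}
    (h : HasSum (fun k => (k.factorial : ℝ)⁻¹ * iteratedDeriv k (fun ρ => S (ρ, δ)) 0 * ρ ^ k)
      (S (ρ, δ))) :
    HasSum (fun j => evenCoeff S j δ * ρ ^ (2 * j)) (S (ρ, δ)) := by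
  refine ((mul_right_injective₀ (two_ne_zero (α := ℕ))).hasSum_iff fun k hk => ?_).2 h
  obtain ⟨j, rfl⟩ : Odd k :=
    Nat.not_even_iff_odd.1 fun ⟨j, hj⟩ => hk ⟨j, (two_mul j).trans hj.symm⟩
  rw [iteratedDeriv_odd_eq_zero_of_even fun x => heven x δ, mul_zero, zero_mul]

end EvenTaylor

section Expansion

theorem isAsymptoticExpansion_iff {E : Type*} {lead : ℝ → ℝ} {e : ℕ → ℝ → ℝ} {h₀ : ℝ}
    {Δ : Set E} {M : ℝ → E → ℝ} {b : ℕ → E → ℝ} :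
    IsAsymptoticExpansion lead e h₀ Δ M b ↔ ∀ N : ℕ, ∃ C : ℝ, ∀ᶠ h in 𝓝[>] h₀, ∀ δ ∈ Δ,
      |M h δ - lead (h - h₀) * ∑ j ∈ Finset.range N, b j δ * e j (h - h₀)|
        ≤ C * (lead (h - h₀) * e N (h - h₀)) := by
  refine forall_congr' fun N => exists_congr fun C => ⟨fun ⟨r, hr, H⟩ => ?_, fun H => ?_⟩
  · filter_upwards [Ioo_mem_nhdsGT (lt_add_of_pos_right h₀ hr)] with h hh δ hδ using H δ hδ h hh
  · obtain ⟨u, hu, H⟩ := mem_nhdsGT_iff_exists_Ioo_subset.1 H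
    exact ⟨u - h₀, sub_pos.2 hu, fun δ hδ h hh => H (by simpa using hh) δ hδ⟩

theorem isConvergentExpansion_iff {E : Type*} {lead : ℝ → ℝ} {e : ℕ → ℝ → ℝ} {h₀ : ℝ}
    {Δ : Set E} {M : ℝ → E → ℝ} {b : ℕ → E → ℝ} :
    IsConvergentExpansion lead e h₀ Δ M b ↔ ∀ᶠ h in 𝓝[>] h₀, ∀ δ ∈ Δ, ∃ S : ℝ,
      HasSum (fun j => b j δ * e j (h - h₀)) S ∧ M h δ = lead (h - h₀) * S := by
  refine ⟨fun ⟨r, hr, H⟩ => ?_, fun H => ?_⟩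
  · filter_upwards [Ioo_mem_nhdsGT (lt_add_of_pos_right h₀ hr)] with h hh δ hδ using H δ hδ h hh
  · obtain ⟨u, hu, H⟩ := mem_nhdsGT_iff_exists_Ioo_subset.1 H
    exact ⟨u - h₀, sub_pos.2 hu, fun δ hδ h hh => H (by simpa using hh) δ hδ⟩

theorem eventually_nhdsGT_zero_of_pow {m : ℕ} (hm : m ≠ 0) {A : ℝ → Prop}
    (hA : ∀ᶠ ρ in 𝓝[>] (0 : ℝ), A (ρ ^ m)) : ∀ᶠ h in 𝓝[>] (0 : ℝ), A h := by
  have hroot : Tendsto (fun h : ℝ => h ^ (m : ℝ)⁻¹) (𝓝[>] 0) (𝓝[>] 0) := by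
    refine tendsto_nhdsWithin_iff.2 ⟨?_, ?_⟩
    · have hcont := Real.continuousAt_rpow_const 0 (m : ℝ)⁻¹ (.inr (by positivity))
      rw [ContinuousAt, Real.zero_rpow (by positivity)] at hcont
      exact hcont.mono_left nhdsWithin_le_nhds
    · filter_upwards [self_mem_nhdsWithin] with h hh using Real.rpow_pos_of_pos hh _
  filter_upwards [hroot.eventually hA, self_mem_nhdsWithin] with h hAh hh
  rwa [Real.rpow_inv_natCast_pow (mem_Ioi.1 hh).le hm] at hAh

theorem pow_two_mul_rpow_succ_div {p : ℕ} (hp : p ≠ 0) {ρ : ℝ} (hρ : 0 ≤ ρ) :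
    (ρ ^ (2 * p)) ^ (((p : ℝ) + 1) / (2 * p)) = ρ ^ (p + 1) := by
  rw [← Real.rpow_natCast ρ (2 * p), ← Real.rpow_mul hρ, ← Real.rpow_natCast ρ (p + 1)]
  congr 1
  push_cast
  field_simp

theorem pow_two_mul_rpow_div {p : ℕ} (hp : p ≠ 0) {ρ : ℝ} (hρ : 0 ≤ ρ) (j : ℕ) :
    (ρ ^ (2 * p)) ^ ((j : ℝ) / p) = ρ ^ (2 * j) := by
  rw [← Real.rpow_natCast ρ (2 * p), ← Real.rpow_mul hρ, ← Real.rpow_natCast ρ (2 * j)]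
  congr 1
  push_cast
  field_simp

variable {E : Type*} [NormedAddCommGroup E] [NormedSpace ℝ E] {Δ : Set E} {S : ℝ × E → ℝ}
  {M : ℝ → E → ℝ} {p : ℕ}

theorem isAsymptoticExpansion_evenCoeff (hΔ : IsCompact Δ)
    (hS : ∀ δ ∈ Δ, ContDiffAt ℝ ∞ S (0, δ)) (heven : ∀ ρ δ, S (-ρ, δ) = S (ρ, δ)) (hp : p ≠ 0)
    (hM : ∀ᶠ ρ in 𝓝[>] (0 : ℝ), ∀ δ ∈ Δ, M (ρ ^ (2 * p)) δ = ρ ^ (p + 1) * S (ρ, δ)) :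
    IsAsymptoticExpansion (fun s => s ^ (((p : ℝ) + 1) / (2 * p))) (fun j s => s ^ ((j : ℝ) / p)) 0
      Δ M (evenCoeff S) := by
  refine isAsymptoticExpansion_iff.2 fun N => ?_
  obtain ⟨C, hC⟩ := exists_bound_sub_sum_evenCoeff hΔ hS heven N
  refine ⟨C, eventually_nhdsGT_zero_of_pow (m := 2 * p) (by positivity) ?_⟩
  filter_upwards [hC, hM, self_mem_nhdsWithin] with ρ hCρ hMρ (hρ : 0 < ρ) δ hδ
  simp only [sub_zero, pow_two_mul_rpow_succ_div hp hρ.le, pow_two_mul_rpow_div hp hρ.le]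
  rw [hMρ δ hδ, ← mul_sub, abs_mul, abs_of_pos (pow_pos hρ _), mul_left_comm]
  exact mul_le_mul_of_nonneg_left (hCρ δ hδ) (by positivity)

theorem isConvergentExpansion_evenCoeff (hΔ : IsCompact Δ)
    (hS : ∀ δ ∈ Δ, AnalyticAt ℝ S (0, δ)) (heven : ∀ ρ δ, S (-ρ, δ) = S (ρ, δ)) (hp : p ≠ 0)
    (hM : ∀ᶠ ρ in 𝓝[>] (0 : ℝ), ∀ δ ∈ Δ, M (ρ ^ (2 * p)) δ = ρ ^ (p + 1) * S (ρ, δ)) :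
    IsConvergentExpansion (fun s => s ^ (((p : ℝ) + 1) / (2 * p))) (fun j s => s ^ ((j : ℝ) / p)) 0
      Δ M (evenCoeff S) := by
  have hsum : ∀ᶠ ρ in 𝓝 (0 : ℝ), ∀ δ ∈ Δ,
      HasSum (fun j => evenCoeff S j δ * ρ ^ (2 * j)) (S (ρ, δ)) := by
    refine hΔ.eventually_forall_of_forall_eventually fun δ hδ => ?_
    exact (eventually_hasSum_of_analyticAt (hS δ hδ)).mono fun w => hasSum_evenCoeff heven
  refine isConvergentExpansion_iff.2
    (eventually_nhdsGT_zero_of_pow (m := 2 * p) (by positivity) ?_)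
  filter_upwards [nhdsWithin_le_nhds hsum, hM, self_mem_nhdsWithin] with ρ hρsum hMρ (hρ : 0 < ρ)
  intro δ hδ
  simp only [sub_zero, pow_two_mul_rpow_succ_div hp hρ.le, pow_two_mul_rpow_div hp hρ.le]
  exact ⟨S (ρ, δ), hρsum δ hδ, hMρ δ hδ⟩

end Expansion

section Transform

variable {a b c d k x₀ y₀ : ℝ} {H : ℝ × ℝ → ℝ}

/-- The linear change of variables
`u = a (x - x₀) + b (y - y₀)`, `v = c (x - x₀) + d (y - y₀)`, with inverse `oldCoords`. -/
def newCoords (a b c d x₀ y₀ : ℝ) (z : ℝ × ℝ) : ℝ × ℝ :=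
  (a * (z.1 - x₀) + b * (z.2 - y₀), c * (z.1 - x₀) + d * (z.2 - y₀))

theorem oldCoords_newCoords (hD : a * d - b * c ≠ 0) (z : ℝ × ℝ) :
    oldCoords a b c d x₀ y₀ (newCoords a b c d x₀ y₀ z) = z := by
  ext <;>
  · simp only [oldCoords, newCoords]
    field_simp
    ring

theorem newCoords_oldCoords (hD : a * d - b * c ≠ 0) (w : ℝ × ℝ) :
    newCoords a b c d x₀ y₀ (oldCoords a b c d x₀ y₀ w) = w := by
  have hinv : 1 / (a * d - b * c) * (a * d - b * c) = 1 := one_div_mul_cancel hD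
  ext <;> simp only [oldCoords, newCoords]
  · linear_combination w.1 * hinv
  · linear_combination w.2 * hinv

/-- The linear part of the coordinate change `newCoords`. -/
def linearCoords (hD : a * d - b * c ≠ 0) : (ℝ × ℝ) ≃L[ℝ] ℝ × ℝ :=
  LinearEquiv.toContinuousLinearEquiv
    { toFun := newCoords a b c d 0 0
      invFun := oldCoords a b c d 0 0
      map_add' := fun z w => by ext <;> simp only [newCoords, Prod.fst_add, Prod.snd_add] <;> ring
      map_smul' := fun r z => by
        ext <;> simp only [newCoords, Prod.smul_fst, Prod.smul_snd, smul_eq_mul, RingHom.id_apply]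
          <;> ring
      left_inv := oldCoords_newCoords hD
      right_inv := newCoords_oldCoords hD }

theorem linearCoords_apply (hD : a * d - b * c ≠ 0) (z : ℝ × ℝ) :
    linearCoords hD z = (a * z.1 + b * z.2, c * z.1 + d * z.2) := by
  simp [linearCoords, newCoords]

theorem linearCoords_symm_apply (hD : a * d - b * c ≠ 0) (w : ℝ × ℝ) :
    (linearCoords hD).symm w = (1 / (a * d - b * c) * (d * w.1 - b * w.2),
      1 / (a * d - b * c) * (-c * w.1 + a * w.2)) := by
  simp [linearCoords, oldCoords]

theorem newCoords_eq_linearCoords (hD : a * d - b * c ≠ 0) (z : ℝ × ℝ) :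
    newCoords a b c d x₀ y₀ z = linearCoords hD (z - (x₀, y₀)) := by
  rw [linearCoords_apply]
  rfl

theorem oldCoords_eq_linearCoords_symm (hD : a * d - b * c ≠ 0) (w : ℝ × ℝ) :
    oldCoords a b c d x₀ y₀ w = (linearCoords hD).symm w + (x₀, y₀) := by
  rw [linearCoords_symm_apply, add_comm]
  rfl

theorem oldCoords_zero : oldCoords a b c d x₀ y₀ (0, 0) = (x₀, y₀) := by
  simp [oldCoords]

theorem newCoords_center : newCoords a b c d x₀ y₀ (x₀, y₀) = (0, 0) := by
  simp [newCoords]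

theorem contDiff_oldCoords {n : WithTop ℕ∞} : ContDiff ℝ n (oldCoords a b c d x₀ y₀) := by
  unfold oldCoords
  fun_prop

theorem tendsto_oldCoords : Tendsto (oldCoords a b c d x₀ y₀) (𝓝 (0, 0)) (𝓝 (x₀, y₀)) := by
  have hcont : Continuous (oldCoords a b c d x₀ y₀) := (contDiff_oldCoords (n := 0)).continuous
  simpa only [oldCoords_zero] using hcont.tendsto (0, 0)

theorem tendsto_newCoords : Tendsto (newCoords a b c d x₀ y₀) (𝓝 (x₀, y₀)) (𝓝 (0, 0)) := by
  have hcont : Continuous (newCoords a b c d x₀ y₀) := by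
    unfold newCoords
    fun_prop
  simpa only [newCoords_center] using hcont.tendsto (x₀, y₀)

theorem newH_center : newH a b c d k x₀ y₀ H (0, 0) = 0 := by
  simp [newH, oldCoords_zero]

theorem fderiv_newH_apply (hD : a * d - b * c ≠ 0) (w v : ℝ × ℝ) :
    fderiv ℝ (newH a b c d k x₀ y₀ H) w v =
      (a * d - b * c) / k * fderiv ℝ H (oldCoords a b c d x₀ y₀ w) ((linearCoords hD).symm v) := by
  have hnewH : newH a b c d k x₀ y₀ H = ((a * d - b * c) / k) •
      fun w => ((fun z => H (z + (x₀, y₀))) ∘ (linearCoords hD).symm) w - H (x₀, y₀) := by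
    ext w
    simp only [newH, oldCoords_eq_linearCoords_symm hD, Pi.smul_apply, smul_eq_mul,
      Function.comp_apply]
  rw [hnewH, fderiv_const_smul_field, Pi.smul_apply, fderiv_sub_const,
    ContinuousLinearEquiv.comp_right_fderiv, fderiv_comp_add_right,
    oldCoords_eq_linearCoords_symm hD]
  rfl

theorem fderiv_mk_apply (z : ℝ × ℝ) (α β : ℝ) :
    fderiv ℝ H z (α, β) = α * partialX H z + β * partialY H z := by
  have hbasis : ((α, β) : ℝ × ℝ) = α • (1, 0) + β • (0, 1) := by simp
  rw [hbasis, map_add, map_smul, map_smul]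
  rfl

theorem partialX_newH (hD : a * d - b * c ≠ 0) (w : ℝ × ℝ) :
    partialX (newH a b c d k x₀ y₀ H) w =
      1 / k * (d * partialX H (oldCoords a b c d x₀ y₀ w)
        - c * partialY H (oldCoords a b c d x₀ y₀ w)) := by
  rw [partialX, fderiv_newH_apply hD, linearCoords_symm_apply, fderiv_mk_apply]
  field_simp
  ring

theorem partialY_newH (hD : a * d - b * c ≠ 0) (w : ℝ × ℝ) :
    partialY (newH a b c d k x₀ y₀ H) w =
      1 / k * (-b * partialX H (oldCoords a b c d x₀ y₀ w)
        + a * partialY H (oldCoords a b c d x₀ y₀ w)) := by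
  rw [partialY, fderiv_newH_apply hD, linearCoords_symm_apply, fderiv_mk_apply]
  field_simp
  ring

theorem abs_mul_div_self_eq_or_eq_neg (hk : k ≠ 0) (T : ℝ) :
    |k| * T / k = T ∨ |k| * T / k = -T := by
  rcases abs_choice k with h | h
  · exact .inl (by rw [h, mul_div_cancel_left₀ _ hk])
  · exact .inr (by rw [h, neg_mul, neg_div, mul_div_cancel_left₀ _ hk])

theorem IsPeriodicOrbit.periodic {F : ℝ × ℝ → ℝ} {h : ℝ} {γ : ℝ → ℝ × ℝ} {T : ℝ}
    (hγ : IsPeriodicOrbit F h γ T) : γ.Periodic T :=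
  hγ.closed

theorem IsPeriodicOrbit.eq_of_abs_sub_lt {F : ℝ × ℝ → ℝ} {h : ℝ} {γ : ℝ → ℝ × ℝ} {T : ℝ}
    (hγ : IsPeriodicOrbit F h γ T) {s t : ℝ} (hst : |s - t| < T) (heq : γ s = γ t) : s = t := by
  wlog hle : s ≤ t generalizing s t
  · exact (this (abs_sub_comm s t ▸ hst) heq.symm (le_of_not_ge hle)).symm
  have hT := hγ.period_pos
  rw [abs_lt] at hst
  exact injOn_Ico_add_of_periodic hγ.periodic hT hγ.simple s ⟨le_rfl, by linarith⟩
    ⟨hle, by linarith⟩ heq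

theorem IsPeriodicOrbit.transform (hD : a * d - b * c ≠ 0) (hk : k ≠ 0) {h : ℝ} {γ : ℝ → ℝ × ℝ}
    {T : ℝ} (hγ : IsPeriodicOrbit H h γ T) :
    IsPeriodicOrbit (newH a b c d k x₀ y₀ H) ((a * d - b * c) / k * (h - H (x₀, y₀)))
      (fun τ => newCoords a b c d x₀ y₀ (γ (τ / k))) (|k| * T) where
  flow τ := by
    have hflow := (linearCoords hD).hasFDerivAt.comp_hasDerivAt τ
      (((hγ.flow (τ / k)).scomp τ ((hasDerivAt_id τ).div_const k)).sub_const (x₀, y₀))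
    simp only [newCoords_eq_linearCoords hD]
    refine hflow.congr_deriv ?_
    rw [partialX_newH hD, partialY_newH hD, ← newCoords_eq_linearCoords hD,
      oldCoords_newCoords hD, ContinuousLinearEquiv.coe_coe, linearCoords_apply]
    ext <;> simp only [Prod.smul_fst, Prod.smul_snd, smul_eq_mul] <;> ring
  period_pos := mul_pos (abs_pos.2 hk) hγ.period_pos
  closed τ := by
    rcases abs_mul_div_self_eq_or_eq_neg hk T with hT | hT
    · rw [add_div, hT, hγ.closed]
    · rw [add_div, hT, ← sub_eq_add_neg, hγ.periodic.sub_eq]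
  simple := by
    intro s hs t ht hst
    have heq : γ (s / k) = γ (t / k) := by
      simpa only [oldCoords_newCoords hD] using congrArg (oldCoords a b c d x₀ y₀) hst
    refine (div_left_inj' hk).1 (hγ.eq_of_abs_sub_lt ?_ heq)
    rw [← sub_div, abs_div, div_lt_iff₀' (abs_pos.2 hk), abs_lt]
    constructor <;> linarith [hs.1, hs.2, ht.1, ht.2]
  level τ := by
    simp only [newH, oldCoords_newCoords hD, hγ.level]

theorem tendsto_add_div_nhdsGT {l : ℝ} (hl : 0 < l) (h₀ : ℝ) :
    Tendsto (fun h : ℝ => h₀ + h / l) (𝓝[>] 0) (𝓝[>] h₀) := by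
  refine tendsto_nhdsWithin_iff.2 ⟨?_, ?_⟩
  · have hcont : Continuous fun h : ℝ => h₀ + h / l := by fun_prop
    simpa only [zero_div, add_zero] using (hcont.tendsto 0).mono_left nhdsWithin_le_nhds
  · filter_upwards [self_mem_nhdsWithin] with h hh
    exact lt_add_of_pos_right _ (div_pos (mem_Ioi.1 hh) hl)

/-- The family of periodic orbits of the transformed system: the level `h` of `newH` is the level
`h₀ + h / (D / k)` of `H`. -/
def CenterFamily.transform (hD : a * d - b * c ≠ 0) (hk : k ≠ 0)
    (hDk : 0 < (a * d - b * c) / k) (L : CenterFamily H (x₀, y₀)) :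
    CenterFamily (newH a b c d k x₀ y₀ H) (0, 0) where
  critical := by
    ext <;> simp [fderiv_newH_apply hD, oldCoords_zero, L.critical]
  β := (a * d - b * c) / k * L.β
  β_pos := mul_pos hDk L.β_pos
  orbit h τ := newCoords a b c d x₀ y₀
    (L.orbit (H (x₀, y₀) + h / ((a * d - b * c) / k)) (τ / k))
  period h := |k| * L.period (H (x₀, y₀) + h / ((a * d - b * c) / k))
  isPeriodicOrbit h hh := by
    rw [newH_center, zero_add] at hh
    have hγ := (L.isPeriodicOrbit (H (x₀, y₀) + h / ((a * d - b * c) / k))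
      ⟨lt_add_of_pos_right _ (div_pos hh.1 hDk),
        add_lt_add_right ((div_lt_iff₀' hDk).2 hh.2) _⟩).transform (x₀ := x₀) (y₀ := y₀) hD hk
    rwa [add_sub_cancel_left, mul_div_cancel₀ _ hDk.ne'] at hγ
  shrinks U hU := by
    rw [newH_center]
    filter_upwards [(tendsto_add_div_nhdsGT hDk _).eventually
      (L.shrinks _ (tendsto_newCoords (a := a) (b := b) (c := c) (d := d) hU))] with h hh
    rintro _ ⟨τ, rfl⟩
    exact hh (mem_range_self _)
  fills := by
    filter_upwards [tendsto_oldCoords (a := a) (b := b) (c := c) (d := d) L.fills] with w hw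
    rcases hw with hw | hw
    · left
      rw [← newCoords_oldCoords (x₀ := x₀) (y₀ := y₀) hD w, hw, newCoords_center]
    · right
      simp only [mem_iUnion] at hw ⊢
      obtain ⟨h, hh, t, ht⟩ := hw
      refine ⟨(a * d - b * c) / k * (h - H (x₀, y₀)), ?_, k * t, ?_⟩
      · rw [newH_center, zero_add]
        exact ⟨mul_pos hDk (sub_pos.2 hh.1),
          mul_lt_mul_of_pos_left (sub_lt_iff_lt_add'.2 hh.2) hDk⟩
      · simp only [mul_div_cancel_left₀ _ hDk.ne', add_sub_cancel, mul_div_cancel_left₀ _ hk, ht,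
          newCoords_oldCoords hD]

theorem integral_comp_div_of_periodic {G : Type*} [NormedAddCommGroup G] [NormedSpace ℝ G]
    (hk : k ≠ 0) {g : ℝ → G} {T : ℝ} (hg : g.Periodic T) :
    ∫ τ in (0 : ℝ)..(|k| * T), g (τ / k) = |k| • ∫ t in (0 : ℝ)..T, g t := by
  rw [intervalIntegral.integral_comp_div _ hk, zero_div]
  rcases abs_choice k with hk' | hk'
  · rw [hk', mul_div_cancel_left₀ _ hk]
  · have hshift := hg.intervalIntegral_add_eq (-T) 0
    rw [neg_add_cancel, zero_add] at hshift
    rw [hk', neg_mul, neg_div, mul_div_cancel_left₀ _ hk, intervalIntegral.integral_symm, hshift,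
      smul_neg, neg_smul]

theorem real_sign_mul_abs (r : ℝ) : Real.sign r * |r| = r := by
  rcases lt_trichotomy r 0 with hr | rfl | hr
  · rw [Real.sign_of_neg hr, abs_of_neg hr, neg_one_mul, neg_neg]
  · rw [abs_zero, mul_zero]
  · rw [Real.sign_of_pos hr, abs_of_pos hr, one_mul]

theorem bracket_transform {E : Type*} (hD : a * d - b * c ≠ 0) (P Q : ℝ × ℝ → E → ℝ) (z : ℝ × ℝ)
    (δ : E) :
    partialY (newH a b c d k x₀ y₀ H) (newCoords a b c d x₀ y₀ z) *
        newQ a b c d k x₀ y₀ P Q (newCoords a b c d x₀ y₀ z) δ +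
      partialX (newH a b c d k x₀ y₀ H) (newCoords a b c d x₀ y₀ z) *
        newP a b c d k x₀ y₀ P Q (newCoords a b c d x₀ y₀ z) δ =
      (a * d - b * c) / k ^ 2 * (partialY H z * Q z δ + partialX H z * P z δ) := by
  rw [partialX_newH hD, partialY_newH hD, newP, newQ, oldCoords_newCoords hD]
  ring

theorem CenterFamily.melnikov_transform {E : Type*} (hD : a * d - b * c ≠ 0) (hk : k ≠ 0)
    (hDk : 0 < (a * d - b * c) / k) (L : CenterFamily H (x₀, y₀)) (P Q : ℝ × ℝ → E → ℝ) {h : ℝ}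
    (hh : h ∈ Ioo (H (x₀, y₀)) (H (x₀, y₀) + L.β)) (δ : E) :
    L.melnikov P Q h δ = Real.sign k * ((a * d - b * c) / k)⁻¹ *
      (L.transform hD hk hDk).melnikov (newP a b c d k x₀ y₀ P Q) (newQ a b c d k x₀ y₀ P Q)
        ((a * d - b * c) / k * (h - H (x₀, y₀))) δ := by
  have hγ := L.isPeriodicOrbit h hh
  have hperiodic : Function.Periodic (fun t => partialY H (L.orbit h t) * Q (L.orbit h t) δ +
      partialX H (L.orbit h t) * P (L.orbit h t) δ) (L.period h) := fun t => by
    simp only [hγ.closed t]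
  have hlevel : H (x₀, y₀) + (a * d - b * c) / k * (h - H (x₀, y₀)) / ((a * d - b * c) / k) =
      h := by
    rw [mul_div_cancel_left₀ _ hDk.ne', add_sub_cancel]
  have hconst : Real.sign k * ((a * d - b * c) / k)⁻¹ * ((a * d - b * c) / k ^ 2 * |k|) = 1 := by
    calc Real.sign k * ((a * d - b * c) / k)⁻¹ * ((a * d - b * c) / k ^ 2 * |k|)
        = Real.sign k * |k| / k * (((a * d - b * c) / k)⁻¹ * ((a * d - b * c) / k)) := by ring
      _ = 1 := by rw [real_sign_mul_abs, div_self hk, inv_mul_cancel₀ hDk.ne', one_mul]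
  simp only [CenterFamily.melnikov, CenterFamily.transform, hlevel, bracket_transform hD]
  rw [intervalIntegral.integral_const_mul, integral_comp_div_of_periodic hk hperiodic, smul_eq_mul,
    ← mul_assoc ((a * d - b * c) / k ^ 2), ← mul_assoc, hconst, one_mul]

end Transform

section Rescaling

variable {E : Type*} {α : ℝ} {β : ℕ → ℝ} {Δ : Set E} {M' M : ℝ → E → ℝ} {B : ℕ → E → ℝ}
  {l σ h₀ : ℝ}

theorem tendsto_mul_sub_nhdsGT (hl : 0 < l) (h₀ : ℝ) :
    Tendsto (fun h => l * (h - h₀)) (𝓝[>] h₀) (𝓝[>] 0) := by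
  refine tendsto_nhdsWithin_iff.2 ⟨?_, ?_⟩
  · have hcont : Continuous fun h : ℝ => l * (h - h₀) := by fun_prop
    simpa only [sub_self, mul_zero] using (hcont.tendsto h₀).mono_left nhdsWithin_le_nhds
  · filter_upwards [self_mem_nhdsWithin] with h hh
    exact mul_pos hl (sub_pos.2 hh)

theorem IsAsymptoticExpansion.comp_mul_sub
    (hM : IsAsymptoticExpansion (fun s => s ^ α) (fun j s => s ^ β j) 0 Δ M' B) (hl : 0 < l)
    (hMM : ∀ᶠ h in 𝓝[>] h₀, ∀ δ ∈ Δ, M h δ = σ * M' (l * (h - h₀)) δ) :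
    IsAsymptoticExpansion (fun s => s ^ α) (fun j s => s ^ β j) h₀ Δ M
      (fun j δ => σ * l ^ (α + β j) * B j δ) := by
  rw [isAsymptoticExpansion_iff] at hM ⊢
  intro N
  obtain ⟨C, hC⟩ := hM N
  refine ⟨|σ| * l ^ (α + β N) * C, ?_⟩
  filter_upwards [(tendsto_mul_sub_nhdsGT hl h₀).eventually hC, hMM, self_mem_nhdsWithin]
    with h hCh hMMh hh δ hδ
  have hs : 0 ≤ h - h₀ := (sub_pos.2 hh).le
  have hbound := hCh δ hδ
  simp only [sub_zero, Real.mul_rpow hl.le hs] at hbound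
  calc _ = |σ| * |M' (l * (h - h₀)) δ - l ^ α * (h - h₀) ^ α *
          ∑ j ∈ Finset.range N, B j δ * (l ^ β j * (h - h₀) ^ β j)| := by
        rw [hMMh δ hδ, ← abs_mul, mul_sub σ, Finset.mul_sum, Finset.mul_sum, Finset.mul_sum]
        congr 2
        refine Finset.sum_congr rfl fun j _ => ?_
        rw [Real.rpow_add hl]
        ring
    _ ≤ |σ| * (C * (l ^ α * (h - h₀) ^ α * (l ^ β N * (h - h₀) ^ β N))) := by gcongr
    _ = _ := by
        rw [Real.rpow_add hl]
        ring

theorem IsConvergentExpansion.comp_mul_sub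
    (hM : IsConvergentExpansion (fun s => s ^ α) (fun j s => s ^ β j) 0 Δ M' B) (hl : 0 < l)
    (hMM : ∀ᶠ h in 𝓝[>] h₀, ∀ δ ∈ Δ, M h δ = σ * M' (l * (h - h₀)) δ) :
    IsConvergentExpansion (fun s => s ^ α) (fun j s => s ^ β j) h₀ Δ M
      (fun j δ => σ * l ^ (α + β j) * B j δ) := by
  rw [isConvergentExpansion_iff] at hM ⊢
  filter_upwards [(tendsto_mul_sub_nhdsGT hl h₀).eventually hM, hMM, self_mem_nhdsWithin]
    with h hSh hMMh hh δ hδ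
  have hs : 0 ≤ h - h₀ := (sub_pos.2 hh).le
  obtain ⟨S, hS, hMS⟩ := hSh δ hδ
  simp only [sub_zero, Real.mul_rpow hl.le hs] at hS hMS
  refine ⟨σ * l ^ α * S, (hS.mul_left (σ * l ^ α)).congr_fun fun j => ?_, ?_⟩
  · rw [Real.rpow_add hl]
    ring
  · rw [hMMh δ hδ, hMS]
    ring

theorem IsExpansion.comp_mul_sub {A : Prop}
    (hM : IsExpansion A (fun s => s ^ α) (fun j s => s ^ β j) 0 Δ M' B) (hl : 0 < l)
    (hMM : ∀ᶠ h in 𝓝[>] h₀, ∀ δ ∈ Δ, M h δ = σ * M' (l * (h - h₀)) δ) :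
    IsExpansion A (fun s => s ^ α) (fun j s => s ^ β j) h₀ Δ M
      (fun j δ => σ * l ^ (α + β j) * B j δ) :=
  ⟨hM.1.comp_mul_sub hl hMM, fun hA => (hM.2 hA).comp_mul_sub hl hMM⟩

theorem IsExpansion.mono {A A' : Prop} {lead : ℝ → ℝ} {e : ℕ → ℝ → ℝ}
    (hM : IsExpansion A lead e h₀ Δ M B) (hA : A' → A) : IsExpansion A' lead e h₀ Δ M B :=
  ⟨hM.1, hM.2 ∘ hA⟩

theorem inv_mul_rpow_add_div (hl : 0 < l) {p : ℕ} (hp : p ≠ 0) (j : ℕ) :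
    l⁻¹ * l ^ (((p : ℝ) + 1) / (2 * p) + (j : ℝ) / p) =
      l ^ ((1 + 2 * (j : ℝ) - p) / (2 * p)) := by
  rw [← Real.rpow_neg_one, ← Real.rpow_add hl]
  congr 1
  field_simp
  ring

end Rescaling

section NormalForm

variable {F : ℝ × ℝ → ℝ} {p : ℕ} {n : WithTop ℕ∞}

theorem IsCenterNormalForm.exists_isBigO (hF : IsCenterNormalForm F p) :
    ∃ κ : ℝ, 0 < κ ∧ (fun v : ℝ => F (0, v) - κ / 2 * v ^ 2) =O[𝓝 0] fun v => v ^ 3 := by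
  obtain ⟨⟨κ, hκ, hform⟩, -⟩ := hF
  have hι : Tendsto (fun v : ℝ => ((0 : ℝ), v)) (𝓝 0) (𝓝 0) :=
    (continuous_const.prodMk continuous_id).tendsto 0
  have hnorm : (fun v : ℝ => ‖((0 : ℝ), v)‖ ^ 3) =O[𝓝 0] fun v : ℝ => v ^ 3 :=
    isBigO_of_le _ fun v => by simp [Prod.norm_def]
  refine ⟨κ, hκ, ?_⟩
  rcases hform with hform | hform
  · simpa [Function.comp_def] using (hform.comp_tendsto hι).trans hnorm
  · exact (hform.comp_tendsto hι).trans hnorm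

theorem IsCenterNormalForm.partialY_partialY_pos (hnf : IsCenterNormalForm F p) (hn : ∞ ≤ n)
    (hp : 1 ≤ p) (hF : ContDiffAt ℝ n F 0) : 0 < partialY (partialY F) 0 := by
  obtain ⟨κ, hκ, hO⟩ := hnf.exists_isBigO
  rw [partialY_partialY_eq hn hF (by simpa only [hnf.2.apply_zero hp, sub_zero] using hO)]
  exact hκ

theorem IsCenterNormalForm.eventually_nonneg (hnf : IsCenterNormalForm F p) (hn : ∞ ≤ n)
    (hp : 1 ≤ p) (hF : ContDiffAt ℝ n F 0) : ∀ᶠ z in 𝓝 0, 0 ≤ F z := by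
  obtain ⟨X, Y, U, V, -, -, -, -, hN⟩ :=
    exists_normalCoordinates hn hF (hnf.partialY_partialY_pos hn hp hF) hp hnf.2
  filter_upwards [hN] with z hz
  rw [hz.eq_pow_add_sq]
  exact add_nonneg ((even_two_mul p).pow_nonneg _) (sq_nonneg _)

theorem IsCenterNormalForm.exists_isExpansion_melnikov {E : Type*} [NormedAddCommGroup E]
    [NormedSpace ℝ E] {P Q : ℝ × ℝ → E → ℝ} {Δ : Set E} (hnf : IsCenterNormalForm F p)
    (hn : ∞ ≤ n) (hp : 1 ≤ p) (hF : ContDiffAt ℝ n F 0) (hΔ : IsCompact Δ)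
    (hP : ∀ δ ∈ Δ, ContDiffAt ℝ n (fun w : (ℝ × ℝ) × E => P w.1 w.2) (0, δ))
    (hQ : ∀ δ ∈ Δ, ContDiffAt ℝ n (fun w : (ℝ × ℝ) × E => Q w.1 w.2) (0, δ)) :
    ∃ B : ℕ → E → ℝ, ∀ L : CenterFamily F (0, 0),
      IsExpansion (n = ω) (fun s => s ^ (((p : ℝ) + 1) / (2 * p))) (fun j s => s ^ ((j : ℝ) / p))
        0 Δ (L.melnikov P Q) B := by
  obtain ⟨S, hS, heven, hM⟩ := exists_melnikov_eq_pow_mul hn hF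
    (hnf.partialY_partialY_pos hn hp hF) hp hnf.2 hΔ hP hQ
  have hp0 : p ≠ 0 := Nat.one_le_iff_ne_zero.1 hp
  refine ⟨evenCoeff S, fun L => ⟨?_, ?_⟩⟩
  · exact isAsymptoticExpansion_evenCoeff hΔ (fun δ hδ => (hS δ hδ).of_le hn) heven hp0 (hM L)
  · rintro rfl
    exact isConvergentExpansion_evenCoeff hΔ (fun δ hδ => (hS δ hδ).analyticAt)
      heven hp0 (hM L)

end NormalForm

section TransformedSystem

variable {E : Type*} [NormedAddCommGroup E] [NormedSpace ℝ E] {n : WithTop ℕ∞}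
  {a b c d k x₀ y₀ : ℝ} {H : ℝ × ℝ → ℝ} {P Q : ℝ × ℝ → E → ℝ} {Δ : Set E} {δ : E}

theorem contDiffAt_newH (hH : ContDiffAt ℝ n H (x₀, y₀)) :
    ContDiffAt ℝ n (newH a b c d k x₀ y₀ H) 0 := by
  refine contDiffAt_const.mul (ContDiffAt.sub ?_ contDiffAt_const)
  refine ContDiffAt.comp (g := H) (0 : ℝ × ℝ) ?_ contDiff_oldCoords.contDiffAt
  rwa [← Prod.mk_zero_zero, oldCoords_zero]

theorem contDiffAt_comp_oldCoords
    (hP : ContDiffAt ℝ n (fun w : (ℝ × ℝ) × E => P w.1 w.2) ((x₀, y₀), δ)) :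
    ContDiffAt ℝ n (fun w : (ℝ × ℝ) × E => P (oldCoords a b c d x₀ y₀ w.1) w.2) (0, δ) := by
  refine ContDiffAt.comp (g := fun w : (ℝ × ℝ) × E => P w.1 w.2)
    (f := fun w : (ℝ × ℝ) × E => (oldCoords a b c d x₀ y₀ w.1, w.2)) (0, δ) ?_
    ((contDiff_oldCoords.contDiffAt.comp _ contDiffAt_fst).prodMk contDiffAt_snd)
  rwa [← Prod.mk_zero_zero, oldCoords_zero]

theorem contDiffAt_newP
    (hP : ContDiffAt ℝ n (fun w : (ℝ × ℝ) × E => P w.1 w.2) ((x₀, y₀), δ))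
    (hQ : ContDiffAt ℝ n (fun w : (ℝ × ℝ) × E => Q w.1 w.2) ((x₀, y₀), δ)) :
    ContDiffAt ℝ n (fun w : (ℝ × ℝ) × E => newP a b c d k x₀ y₀ P Q w.1 w.2) (0, δ) :=
  contDiffAt_const.mul ((contDiffAt_const.mul (contDiffAt_comp_oldCoords hP)).add
    (contDiffAt_const.mul (contDiffAt_comp_oldCoords hQ)))

theorem contDiffAt_newQ
    (hP : ContDiffAt ℝ n (fun w : (ℝ × ℝ) × E => P w.1 w.2) ((x₀, y₀), δ))
    (hQ : ContDiffAt ℝ n (fun w : (ℝ × ℝ) × E => Q w.1 w.2) ((x₀, y₀), δ)) :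
    ContDiffAt ℝ n (fun w : (ℝ × ℝ) × E => newQ a b c d k x₀ y₀ P Q w.1 w.2) (0, δ) :=
  contDiffAt_const.mul ((contDiffAt_const.mul (contDiffAt_comp_oldCoords hP)).add
    (contDiffAt_const.mul (contDiffAt_comp_oldCoords hQ)))

theorem exists_contDiffAt_class {z₀ : ℝ × ℝ} (hH : ContDiffAt ℝ ∞ H z₀)
    (hP : ∀ δ ∈ Δ, ContDiffAt ℝ ∞ (fun w : (ℝ × ℝ) × E => P w.1 w.2) (z₀, δ))
    (hQ : ∀ δ ∈ Δ, ContDiffAt ℝ ∞ (fun w : (ℝ × ℝ) × E => Q w.1 w.2) (z₀, δ)) :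
    ∃ n : WithTop ℕ∞, ∞ ≤ n ∧ (IsAnalyticSystem H P Q z₀ Δ → n = ω) ∧ ContDiffAt ℝ n H z₀ ∧
      (∀ δ ∈ Δ, ContDiffAt ℝ n (fun w : (ℝ × ℝ) × E => P w.1 w.2) (z₀, δ)) ∧
      ∀ δ ∈ Δ, ContDiffAt ℝ n (fun w : (ℝ × ℝ) × E => Q w.1 w.2) (z₀, δ) := by
  by_cases hA : IsAnalyticSystem H P Q z₀ Δ
  · exact ⟨ω, le_top, fun _ => rfl, hA.1.contDiffAt, fun δ hδ => (hA.2 δ hδ).1.contDiffAt,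
      fun δ hδ => (hA.2 δ hδ).2.contDiffAt⟩
  · exact ⟨∞, le_rfl, fun h => absurd h hA, hH, hP, hQ⟩

theorem CenterFamily.eventually_lt {z₀ : ℝ × ℝ} (L : CenterFamily H z₀) :
    ∀ᶠ z in 𝓝[≠] z₀, H z₀ < H z := by
  filter_upwards [nhdsWithin_le_nhds L.fills, self_mem_nhdsWithin] with z hz hne
  have hz' := hz.resolve_left hne
  simp only [mem_iUnion] at hz'
  obtain ⟨h, hh, t, rfl⟩ := hz'
  rw [(L.isPeriodicOrbit h hh).level]
  exact hh.1

theorem IsCenterNormalForm.div_pos {p : ℕ}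
    (hnf : IsCenterNormalForm (newH a b c d k x₀ y₀ H) p) (hp : 1 ≤ p)
    (hH : ContDiffAt ℝ ∞ H (x₀, y₀)) (L : CenterFamily H (x₀, y₀)) (hD : a * d - b * c ≠ 0)
    (hk : k ≠ 0) : 0 < (a * d - b * c) / k := by
  have hnonneg := hnf.eventually_nonneg le_rfl hp (contDiffAt_newH hH)
  obtain ⟨z, hz, hlt⟩ := (((tendsto_newCoords.mono_left nhdsWithin_le_nhds).eventually
    hnonneg).and L.eventually_lt).exists
  rw [newH, oldCoords_newCoords hD] at hz
  exact (nonneg_of_mul_nonneg_left hz (sub_pos.2 hlt)).lt_of_ne' (div_ne_zero hD hk)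

theorem CenterFamily.isExpansion_of_transform {E : Type*} {A : Prop} {p : ℕ} {Δ : Set E}
    {P Q : ℝ × ℝ → E → ℝ} {B : ℕ → E → ℝ} (hp : p ≠ 0) (hD : a * d - b * c ≠ 0) (hk : k ≠ 0)
    (hDk : 0 < (a * d - b * c) / k) (L : CenterFamily H (x₀, y₀))
    (hB : IsExpansion A (fun s => s ^ (((p : ℝ) + 1) / (2 * p))) (fun j s => s ^ ((j : ℝ) / p)) 0 Δ
      ((L.transform hD hk hDk).melnikov (newP a b c d k x₀ y₀ P Q)
        (newQ a b c d k x₀ y₀ P Q)) B) :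
    IsExpansion A (fun s => s ^ (((p : ℝ) + 1) / (2 * p))) (fun j s => s ^ ((j : ℝ) / p))
      (H (x₀, y₀)) Δ (L.melnikov P Q) (fun j δ => Real.sign k *
        ((a * d - b * c) / k) ^ ((1 + 2 * (j : ℝ) - p) / (2 * p)) * B j δ) := by
  have hMM : ∀ᶠ h in 𝓝[>] H (x₀, y₀), ∀ δ ∈ Δ, L.melnikov P Q h δ =
      Real.sign k * ((a * d - b * c) / k)⁻¹ * (L.transform hD hk hDk).melnikov
        (newP a b c d k x₀ y₀ P Q) (newQ a b c d k x₀ y₀ P Q)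
        ((a * d - b * c) / k * (h - H (x₀, y₀))) δ := by
    filter_upwards [Ioo_mem_nhdsGT (lt_add_of_pos_right _ L.β_pos)] with h hh δ _
    exact L.melnikov_transform hD hk hDk P Q hh δ
  simpa only [mul_assoc (Real.sign k), inv_mul_rpow_add_div hDk hp] using hB.comp_mul_sub hDk hMM

end TransformedSystem

end NearHamiltonian

end

open NearHamiltonian in
theorem theorem6_general {E : Type*} [NormedAddCommGroup E] [NormedSpace ℝ E] {H : ℝ × ℝ → ℝ}
    {P Q : ℝ × ℝ → E → ℝ} {Δ : Set E} (hΔ : IsCompact Δ) {x₀ y₀ : ℝ}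
    (hH : ContDiffAt ℝ ∞ H (x₀, y₀))
    (hP : ∀ δ ∈ Δ, ContDiffAt ℝ ∞ (fun w : (ℝ × ℝ) × E => P w.1 w.2) ((x₀, y₀), δ))
    (hQ : ∀ δ ∈ Δ, ContDiffAt ℝ ∞ (fun w : (ℝ × ℝ) × E => Q w.1 w.2) ((x₀, y₀), δ))
    (L : CenterFamily H (x₀, y₀)) {a b c d k : ℝ} (hD : a * d - b * c ≠ 0) (hk : k ≠ 0)
    {p : ℕ} (hp : 1 ≤ p) (hnf : IsCenterNormalForm (newH a b c d k x₀ y₀ H) p) :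
    Nonempty (CenterFamily (newH a b c d k x₀ y₀ H) (0, 0)) ∧
    ∃ B : ℕ → E → ℝ,
      (∀ L' : CenterFamily (newH a b c d k x₀ y₀ H) (0, 0),
        IsExpansion (IsAnalyticSystem H P Q (x₀, y₀) Δ)
          (fun s => s ^ (((p : ℝ) + 1) / (2 * p))) (fun j s => s ^ ((j : ℝ) / p)) 0 Δ
          (L'.melnikov (newP a b c d k x₀ y₀ P Q) (newQ a b c d k x₀ y₀ P Q)) B) ∧
      IsExpansion (IsAnalyticSystem H P Q (x₀, y₀) Δ)
        (fun s => s ^ (((p : ℝ) + 1) / (2 * p))) (fun j s => s ^ ((j : ℝ) / p)) (H (x₀, y₀)) Δ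
        (L.melnikov P Q) (fun j δ => Real.sign k *
          ((a * d - b * c) / k) ^ ((1 + 2 * (j : ℝ) - p) / (2 * p)) * B j δ) ∧
      (p = 1 →
        IsExpansion (IsAnalyticSystem H P Q (x₀, y₀) Δ)
          (fun s => s) (fun j s => s ^ j) (H (x₀, y₀)) Δ (L.melnikov P Q)
          (fun j δ => Real.sign k * ((a * d - b * c) / k) ^ j * B j δ)) := by
  have hDk := hnf.div_pos hp hH L hD hk
  obtain ⟨n, hn, hA, hHn, hPn, hQn⟩ := exists_contDiffAt_class hH hP hQ
  obtain ⟨B, hB⟩ := hnf.exists_isExpansion_melnikov hn hp (contDiffAt_newH hHn) hΔ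
    (fun δ hδ => contDiffAt_newP (hPn δ hδ) (hQn δ hδ))
    (fun δ hδ => contDiffAt_newQ (hPn δ hδ) (hQn δ hδ))
  have hM := L.isExpansion_of_transform (Nat.one_le_iff_ne_zero.1 hp) hD hk hDk
    ((hB (L.transform hD hk hDk)).mono hA)
  refine ⟨⟨L.transform hD hk hDk⟩, B, fun L' => (hB L').mono hA, hM, ?_⟩
  rintro rfl
  have hexponent (j : ℕ) : (1 + 2 * (j : ℝ) - 1) / 2 = j := by ring
  simpa only [Nat.cast_one, mul_one, one_add_one_eq_two, div_self (two_ne_zero' ℝ), div_one,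
    Real.rpow_one, Real.rpow_natCast, hexponent] using hM

theorem theorem6 {m : ℕ} (H : ℝ × ℝ → ℝ) (P Q : ℝ × ℝ → EuclideanSpace ℝ (Fin m) → ℝ)
    (Δ V : Set (EuclideanSpace ℝ (Fin m))) (hΔ : IsCompact Δ) (hV : IsOpen V) (hΔV : Δ ⊆ V)
    (hH : ContDiff ℝ ∞ H)
    (hP : ContDiffOn ℝ ∞ (fun w : (ℝ × ℝ) × EuclideanSpace ℝ (Fin m) => P w.1 w.2) (univ ×ˢ V))
    (hQ : ContDiffOn ℝ ∞ (fun w : (ℝ × ℝ) × EuclideanSpace ℝ (Fin m) => Q w.1 w.2) (univ ×ˢ V))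
    (x₀ y₀ h₀ : ℝ) (hh₀ : H (x₀, y₀) = h₀)
    (L : NearHamiltonian.CenterFamily H (x₀, y₀))
    (a b c d D k : ℝ) (hD : D = a * d - b * c) (hD0 : D ≠ 0) (hk : k ≠ 0)
    (p : ℕ) (hp : 1 ≤ p)
    (hnf : NearHamiltonian.IsCenterNormalForm (NearHamiltonian.newH a b c d k x₀ y₀ H) p) :
    Nonempty (NearHamiltonian.CenterFamily (NearHamiltonian.newH a b c d k x₀ y₀ H) (0, 0)) ∧
    ∃ B : ℕ → EuclideanSpace ℝ (Fin m) → ℝ,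
      (∀ L' : NearHamiltonian.CenterFamily (NearHamiltonian.newH a b c d k x₀ y₀ H) (0, 0),
        NearHamiltonian.IsExpansion
          (NearHamiltonian.IsAnalyticSystem H P Q (x₀, y₀) Δ)
          (fun s => s ^ (((p : ℝ) + 1) / (2 * p))) (fun j s => s ^ ((j : ℝ) / p)) 0 Δ
          (L'.melnikov (NearHamiltonian.newP a b c d k x₀ y₀ P Q)
            (NearHamiltonian.newQ a b c d k x₀ y₀ P Q))
          B) ∧
      NearHamiltonian.IsExpansion
        (NearHamiltonian.IsAnalyticSystem H P Q (x₀, y₀) Δ)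
        (fun s => s ^ (((p : ℝ) + 1) / (2 * p))) (fun j s => s ^ ((j : ℝ) / p)) h₀ Δ
        (L.melnikov P Q)
        (fun j δ => Real.sign k * (D / k) ^ ((1 + 2 * (j : ℝ) - p) / (2 * p)) * B j δ) ∧
      (p = 1 →
        NearHamiltonian.IsExpansion
          (NearHamiltonian.IsAnalyticSystem H P Q (x₀, y₀) Δ)
          (fun s => s) (fun j s => s ^ j) h₀ Δ
          (L.melnikov P Q)
          (fun j δ => Real.sign k * (D / k) ^ j * B j δ)) := by
  subst hD hh₀
  exact theorem6_general hΔ hH.contDiffAt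
    (fun δ hδ => hP.contDiffAt (prod_mem_nhds univ_mem (hV.mem_nhds (hΔV hδ))))
    (fun δ hδ => hQ.contDiffAt (prod_mem_nhds univ_mem (hV.mem_nhds (hΔV hδ)))) L hD0 hk hp hnf
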